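/- Let $N\ge 1$ be an integer. For an integer $k$ with $1\le k<N$ let $I_k^{\pm}\subset\mathbb{C}[x]=\mathbb{C}[x_1,\dots,x_N]$ be the ideal of polynomials vanishing on all planes $\varepsilon_{1}x_{i_1}=\varepsilon_{2}x_{i_2}=\dots=\varepsilon_{k+1}x_{i_{k+1}}$ with $1\le i_1<\dots<i_{k+1}\le N$ and signs $\varepsilon_1,\dots,\varepsilon_{k+1}\in\{1,-1\}$. For an integer $k$ with $0\le k\le N-1$ let $J_k\subset\mathbb{C}[x]$ be the ideal of polynomials vanishing on all planes $x_{i_1}=\dots=x_{i_{k+1}}=0$ with $1\le i_1<\dots<i_{k+1}\le N$. Then the function $$g(x)=\frac{f(x)}{\prod_{1\le i<j\le N}|x_i^2-x_j^2|^{\frac1r}\,\prod_{i=1}^N|x_i|^{\frac12-\frac sr}}$$ on $\mathbb{R}^N$ (defined almost everywhere) is locally $L^2$-integrable, that is, every point of $\mathbb{R}^N$ has a neighbourhood $U$ with $\int_U|g|^2\,dx<\infty$, in each of the following cases: (i) $f\in I_{r-1}^{\pm}$, where $r\in\mathbb{Z}$, $2\le r\le N$, and $s\in\mathbb{R}$,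 $s\ge r-1$; (ii) $f\in J_s$, where $s\in\mathbb{Z}$, $0\le s\le N-1$, and $r\in\mathbb{R}$, $r\ge N+1$; (iii) $f\in\mathbb{C}[x]$ is arbitrary, $s\in\mathbb{R}$, $s>N-1$, and $r\in\mathbb{R}$, $r\ge N+1$; (iv) $f\in\mathbb{C}[x]$ is arbitrary, and $r,s\in\mathbb{R}$, $r<0$, $s<0$. -/

import Mathlib

open MeasureTheory Topology

noncomputable section

/-- The union of the planes `ε_{i₁} x_{i₁} = ⋯ = ε_{i_{k+1}} x_{i_{k+1}}` in `ℂ^N`, over all sets of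
`k + 1` indices and all choices of signs `ε_i = ±1`. -/
def signedDiagonals (N k : ℕ) : Set (Fin N → ℂ) :=
  {x | ∃ S : Finset (Fin N), S.card = k + 1 ∧
    ∃ ε : Fin N → ℂ, (∀ i, ε i = 1 ∨ ε i = -1) ∧ ∀ i ∈ S, ∀ j ∈ S, ε i * x i = ε j * x j}

/-- The union of the planes `x_{i₁} = ⋯ = x_{i_{k+1}} = 0` in `ℂ^N`, over all sets of
`k + 1` indices. -/
def coordinatePlanes (N k : ℕ) : Set (Fin N → ℂ) :=
  {x | ∃ S : Finset (Fin N), S.card = k + 1 ∧ ∀ i ∈ S, x i = 0}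

/-- The ideal `I_k^±` of polynomials in `ℂ[x₁, …, x_N]` vanishing on `signedDiagonals N k`. -/
def idealIpm (N k : ℕ) : Ideal (MvPolynomial (Fin N) ℂ) :=
  MvPolynomial.vanishingIdeal ℂ (signedDiagonals N k)

/-- The ideal `J_k` of polynomials in `ℂ[x₁, …, x_N]` vanishing on `coordinatePlanes N k`. -/
def idealJ (N k : ℕ) : Ideal (MvPolynomial (Fin N) ℂ) :=
  MvPolynomial.vanishingIdeal ℂ (coordinatePlanes N k)

/-- The function `f / (∏_{i<j} |x_i² - x_j²|^{1/r} ∏_i |x_i|^{1/2 - s/r})` on `ℝ^N`. The real powers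
are taken of absolute values; any other branch of the powers has the same modulus. The values on
the hyperplanes where a base vanishes (a null set) are irrelevant. -/
def bTypeFunction {N : ℕ} (f : MvPolynomial (Fin N) ℂ) (r s : ℝ) (x : Fin N → ℝ) : ℂ :=
  MvPolynomial.eval (fun i => (x i : ℂ)) f /
    (((∏ i, ∏ j ∈ Finset.Ioi i, |x i ^ 2 - x j ^ 2| ^ (1 / r)) *
      ∏ i, |x i| ^ (1 / 2 - s / r) : ℝ) : ℂ)

/-- `g` is locally `L²`-integrable on `ℝ^N`: each point has a neighbourhood `U` with
`∫_U |g|² < ∞` (Lebesgue measure), `g` being a.e. strongly measurable there. -/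
def LocallyL2Integrable {N : ℕ} (g : (Fin N → ℝ) → ℂ) : Prop :=
  ∀ P : Fin N → ℝ, ∃ U ∈ 𝓝 P, MemLp g 2 (volume.restrict U)

end

section CollapsingDegree

open MvPolynomial

variable {ι : Type*}

theorem totalDegree_aeval_le_of_totalDegree_le_one {R : Type*} [CommSemiring R]
    (g : ι → MvPolynomial ι R) (hg : ∀ i, (g i).totalDegree ≤ 1) (p : MvPolynomial ι R) :
    (aeval g p).totalDegree ≤ p.totalDegree := by
  rw [aeval_def, eval₂_eq]
  refine (totalDegree_finsetSum _ _).trans (Finset.sup_le fun s hs => ?_)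
  refine (totalDegree_mul _ _).trans ?_
  have h0 : (algebraMap R (MvPolynomial ι R) (coeff s p)).totalDegree = 0 := totalDegree_C _
  rw [h0, zero_add]
  refine (totalDegree_finsetProd _ _).trans ?_
  refine le_trans (Finset.sum_le_sum fun i _ => ?_) (le_totalDegree hs)
  refine (totalDegree_pow _ _).trans ?_
  simpa using Nat.mul_le_mul_left (s i) (hg i)

variable [DecidableEq ι]

/-- The substitution `X w ↦ c * X i₀`. -/
noncomputable def mergeVar (i₀ w : ι) (c : ℂ) : MvPolynomial ι ℂ →ₐ[ℂ] MvPolynomial ι ℂ :=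
  aeval (Function.update X w (C c * X i₀))

/-- The substitution `X i ↦ η i * X i₀` for `i ∈ G`. -/
noncomputable def collapseVars (i₀ : ι) (G : Finset ι) (η : ι → ℂ) :
    MvPolynomial ι ℂ →ₐ[ℂ] MvPolynomial ι ℂ :=
  aeval fun i => if i ∈ G then C (η i) * X i₀ else X i

theorem dvd_of_mergeVar_eq_zero {i₀ w : ι} {c : ℂ} {p : MvPolynomial ι ℂ}
    (h : mergeVar i₀ w c p = 0) : X w - C c * X i₀ ∣ p := by
  rw [← Ideal.mem_span_singleton, ← Ideal.Quotient.eq_zero_iff_mem]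
  set I := Ideal.span {(X w - C c * X i₀ : MvPolynomial ι ℂ)}
  have key : (Ideal.Quotient.mkₐ ℂ I).comp (mergeVar i₀ w c) = Ideal.Quotient.mkₐ ℂ I := by
    refine algHom_ext fun i => ?_
    by_cases hi : i = w
    · subst hi
      simp only [AlgHom.comp_apply, mergeVar, aeval_X, Function.update_self]
      refine Ideal.Quotient.eq.2 ?_
      rw [← neg_sub]
      exact I.neg_mem (Ideal.subset_span rfl)
    · simp [mergeVar, Function.update_of_ne hi]
  have := DFunLike.congr_fun key p
  rw [AlgHom.comp_apply, h, map_zero] at this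
  exact this.symm

theorem X_sub_C_mul_X_ne_zero {i₀ w : ι} (hw : w ≠ i₀) (c : ℂ) :
    (X w - C c * X i₀ : MvPolynomial ι ℂ) ≠ 0 := by
  intro h
  have := congrArg (eval (Pi.single w (1 : ℂ))) h
  simp [Pi.single_eq_of_ne hw.symm] at this

theorem one_le_totalDegree_X_sub {i₀ w : ι} (hw : w ≠ i₀) (c : ℂ) :
    1 ≤ (X w - C c * X i₀ : MvPolynomial ι ℂ).totalDegree := by
  by_contra! h
  have h0 := (totalDegree_eq_zero_iff_eq_C (p := (X w - C c * X i₀ : MvPolynomial ι ℂ))).1 (by omega)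
  have h1 := congrArg (eval (Pi.single w (1 : ℂ))) h0
  have h2 := congrArg (eval (0 : ι → ℂ)) h0
  simp [Pi.single_eq_of_ne hw.symm] at h1 h2

theorem mergeVar_linear_ne_zero {i₀ w w' : ι} (hw : w ≠ i₀) (hw' : w' ≠ i₀) {c c' : ℂ}
    (h : (w', c') ≠ (w, c)) : mergeVar i₀ w c (X w' - C c' * X i₀) ≠ 0 := by
  by_cases hww : w' = w
  · subst hww
    have hc : c - c' ≠ 0 := fun h0 => h (by rw [sub_eq_zero.1 h0])
    have : mergeVar i₀ w' c (X w' - C c' * X i₀) = C (c - c') * X i₀ := by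
      simp [mergeVar, Function.update_of_ne hw.symm, algebraMap_eq, sub_mul]
    rw [this]
    exact mul_ne_zero (C_ne_zero.2 hc) (X_ne_zero _)
  · have : mergeVar i₀ w c (X w' - C c' * X i₀) = X w' - C c' * X i₀ := by
      simp [mergeVar, Function.update_of_ne hww, Function.update_of_ne hw.symm, algebraMap_eq]
    rw [this]
    exact X_sub_C_mul_X_ne_zero hw' c'

/-- A polynomial vanishing on distinct hyperplanes `x w = c * x i₀` is divisible by the product of
the corresponding linear forms. -/
theorem exists_eq_prod_mul_of_mergeVar_eq_zero {i₀ : ι} (A : Finset (ι × ℂ))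
    (hA : ∀ a ∈ A, a.1 ≠ i₀) {p : MvPolynomial ι ℂ} (hp : p ≠ 0)
    (h : ∀ a ∈ A, mergeVar i₀ a.1 a.2 p = 0) :
    ∃ p', p = (∏ a ∈ A, (X a.1 - C a.2 * X i₀)) * p' ∧ p' ≠ 0 ∧
      A.card + p'.totalDegree ≤ p.totalDegree := by
  classical
  induction A using Finset.induction_on with
  | empty => exact ⟨p, by simp, hp, by simp⟩
  | insert a A ha ih =>
    obtain ⟨q, hq, hq0, hdeg⟩ := ih (fun b hb => hA b (Finset.mem_insert_of_mem hb))
      (fun b hb => h b (Finset.mem_insert_of_mem hb))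
    have hai := hA a (Finset.mem_insert_self _ _)
    have h1 := h a (Finset.mem_insert_self _ _)
    rw [hq, map_mul, map_prod, mul_eq_zero] at h1
    have h2 : mergeVar i₀ a.1 a.2 q = 0 := by
      refine h1.resolve_left (Finset.prod_ne_zero_iff.2 fun b hb => ?_)
      refine mergeVar_linear_ne_zero hai (hA b (Finset.mem_insert_of_mem hb)) ?_
      exact fun hba => ha ((show b = a from hba) ▸ hb)
    obtain ⟨q', hq'⟩ := dvd_of_mergeVar_eq_zero h2
    have hq'0 : q' ≠ 0 := by
      rintro rfl
      exact hq0 (by simpa using hq')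
    refine ⟨q', ?_, hq'0, ?_⟩
    · rw [Finset.prod_insert ha, hq, hq']
      ring
    · rw [Finset.card_insert_of_notMem ha]
      have := totalDegree_mul_of_isDomain (X_sub_C_mul_X_ne_zero hai a.2) hq'0
      rw [← hq'] at this
      have := one_le_totalDegree_X_sub hai a.2
      omega

theorem mergeVar_collapseVars {i₀ w : ι} {G : Finset ι} (hw : w ∉ G) (hi : i₀ ∈ G)
    (η : ι → ℂ) (c : ℂ) (p : MvPolynomial ι ℂ) :
    mergeVar i₀ w c (collapseVars i₀ G η p) =
      collapseVars i₀ (insert w G) (Function.update η w c) p := by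
  have hne : i₀ ≠ w := fun h => hw (h ▸ hi)
  rw [← AlgHom.comp_apply]
  congr 1
  refine algHom_ext fun i => ?_
  by_cases hiw : i = w
  · subst hiw
    simp [mergeVar, collapseVars, hw]
  · by_cases hiG : i ∈ G
    · simp [mergeVar, collapseVars, hiG, Function.update_of_ne hne, Function.update_of_ne hiw,
        algebraMap_eq]
    · simp [mergeVar, collapseVars, hiG, hiw]

theorem eval_collapseVars (i₀ : ι) (G : Finset ι) (η v : ι → ℂ) (p : MvPolynomial ι ℂ) :
    eval v (collapseVars i₀ G η p) = eval (fun i => if i ∈ G then η i * v i₀ else v i) p := by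
  rw [collapseVars, aeval_def, eval_eval₂, eval]
  congr 1
  · ext; simp
  · funext i
    split_ifs <;> simp

theorem totalDegree_collapseVars_le (i₀ : ι) (G : Finset ι) (η : ι → ℂ) (p : MvPolynomial ι ℂ) :
    (collapseVars i₀ G η p).totalDegree ≤ p.totalDegree := by
  refine totalDegree_aeval_le_of_totalDegree_le_one _ (fun i => ?_) p
  split_ifs
  · refine (totalDegree_mul _ _).trans ?_
    simp
  · simp

/-- The vectors whose coordinates at some `k + 1` indices of `V` with a common label `q` agree up
to signs in `H q`. -/
def blockDiagonals {ι : Type*} (H : ℕ → Finset ℂ) (β : ι → ℕ) (k : ℕ) (V : Finset ι) :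
    Set (ι → ℂ) :=
  {v | ∃ S ⊆ V, S.card = k + 1 ∧ ∃ q, (∀ i ∈ S, β i = q) ∧ ∃ ε : ι → ℂ, (∀ i, ε i ∈ H q) ∧
    ∀ i ∈ S, ∀ j ∈ S, ε i * v i = ε j * v j}

/-- A lower bound for the degree of a nonzero polynomial in `m` variables that vanishes whenever
`k + 1` of them coincide. -/
noncomputable def collapseOrder (k m : ℕ) : ℝ := max 0 ((m : ℝ) * (m - k) / (2 * k))

theorem collapseOrder_nonneg (k m : ℕ) : 0 ≤ collapseOrder k m := le_max_left _ _

theorem collapseOrder_le_add {k m g : ℕ} (hk : 1 ≤ k) (hgk : g ≤ k) (hgm : g ≤ m) :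
    collapseOrder k m ≤ ((m - g : ℕ) : ℝ) + collapseOrder k (m - g) := by
  have hk' : (0 : ℝ) < 2 * k := by positivity
  have h2 : (g : ℝ) ≤ k := by exact_mod_cast hgk
  have h3 : (g : ℝ) ≤ m := by exact_mod_cast hgm
  have h0 : (0 : ℝ) ≤ g := by positivity
  refine max_le (add_nonneg (by positivity) (collapseOrder_nonneg _ _)) ?_
  refine le_trans ?_ (add_le_add_right (le_max_right _ _) _)
  rw [Nat.cast_sub hgm, div_le_iff₀ hk', add_mul, div_mul_cancel₀ _ hk'.ne']
  nlinarith [mul_nonneg (sub_nonneg.2 h2) (by linarith : (0 : ℝ) ≤ 2 * m - g)]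

theorem sum_collapseOrder_le_totalDegree (H : ℕ → Finset ℂ) (hH : ∀ q, ∀ c ∈ H q, c = 1 ∨ c = -1)
    (hH1 : ∀ q, 1 ∈ H q) (β : ι → ℕ) {k : ℕ} (hk : 1 ≤ k) (Q : Finset ℕ) (V : Finset ι)
    (h : MvPolynomial ι ℂ) (h0 : h ≠ 0) (hβ : ∀ i ∈ V, β i ∈ Q)
    (hv : ∀ v ∈ blockDiagonals H β k V, eval v h = 0) :
    ∑ q ∈ Q, ((H q).card : ℝ) * collapseOrder k (V.filter fun i => β i = q).card
      ≤ h.totalDegree := by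
  classical
  induction hn : V.card using Nat.strong_induction_on generalizing V h with
  | _ n ih =>
  rcases V.eq_empty_or_nonempty with rfl | ⟨i₀, hi₀⟩
  · have : collapseOrder k 0 = 0 := by simp [collapseOrder]
    simp [this]
  set q := β i₀ with hq
  set B := V.filter fun i => β i = q with hB
  have hi₀B : i₀ ∈ B := by simp [hB, hi₀, hq]
  -- the index sets that can be collapsed onto `i₀` without killing `h`
  let good : Finset (Finset ι) := B.powerset.filter fun G => i₀ ∈ G ∧
    ∃ η : ι → ℂ, (∀ i, η i ∈ H q) ∧ η i₀ = 1 ∧ collapseVars i₀ G η h ≠ 0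
  have hgood : good.Nonempty := by
    refine ⟨{i₀}, ?_⟩
    simp only [good, Finset.mem_filter, Finset.mem_powerset, Finset.singleton_subset_iff]
    refine ⟨hi₀B, Finset.mem_singleton_self _, fun _ => 1, fun _ => hH1 q, rfl, ?_⟩
    have : collapseVars i₀ {i₀} (fun _ => (1 : ℂ)) = AlgHom.id ℂ _ := by
      refine algHom_ext fun i => ?_
      by_cases hi : i = i₀ <;> simp [collapseVars, hi]
    rwa [this]
  obtain ⟨G, hG, hmax⟩ := good.exists_max_image Finset.card hgood
  simp only [good, Finset.mem_filter, Finset.mem_powerset] at hG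
  obtain ⟨hGB, hi₀G, η, hηH, hη1, hne⟩ := hG
  have hGV : G ⊆ V := hGB.trans (Finset.filter_subset _ _)
  have hGq : ∀ i ∈ G, β i = q := fun i hi => (Finset.mem_filter.1 (hGB hi)).2
  have hη2 : ∀ i, η i * η i = 1 := fun i => by
    rcases hH q _ (hηH i) with h1 | h1 <;> simp [h1]
  have hgk : G.card ≤ k := by
    by_contra! hlt
    obtain ⟨S, hSG, hS⟩ := Finset.exists_subset_card_eq (Nat.succ_le_of_lt hlt)
    refine hne (MvPolynomial.funext fun v => ?_)
    rw [eval_collapseVars, map_zero]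
    refine hv _ ⟨S, hSG.trans hGV, hS, q, fun i hi => hGq i (hSG hi), η, hηH, fun i hi j hj => ?_⟩
    simp only [hSG hi, hSG hj, if_true, ← mul_assoc, hη2]
  set A : Finset (ι × ℂ) := (B \ G) ×ˢ H q with hA
  have hA0 : ∀ a ∈ A, a.1 ≠ i₀ := by
    rintro ⟨w, c⟩ ha rfl
    simp only [hA, Finset.mem_product, Finset.mem_sdiff] at ha
    exact ha.1.2 hi₀G
  have hA1 : ∀ a ∈ A, mergeVar i₀ a.1 a.2 (collapseVars i₀ G η h) = 0 := by
    rintro ⟨w, c⟩ ha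
    simp only [hA, Finset.mem_product, Finset.mem_sdiff] at ha
    obtain ⟨⟨hwB, hwG⟩, hc⟩ := ha
    by_contra hcon
    rw [mergeVar_collapseVars hwG hi₀G] at hcon
    have := hmax (insert w G) (by
      simp only [good, Finset.mem_filter, Finset.mem_powerset]
      refine ⟨Finset.insert_subset hwB hGB, Finset.mem_insert_of_mem hi₀G, _, fun i => ?_, ?_, hcon⟩
      · by_cases hi : i = w
        · simpa [hi] using hc
        · simpa [Function.update_of_ne hi] using hηH i
      · rw [Function.update_of_ne (fun heq => hwG (heq ▸ hi₀G) : i₀ ≠ w), hη1])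
    rw [Finset.card_insert_of_notMem hwG] at this
    omega
  obtain ⟨h', hh', hh'0, hdeg⟩ := exists_eq_prod_mul_of_mergeVar_eq_zero A hA0 hne hA1
  have hcard : (V \ G).card < n := by
    rw [← hn]
    exact Finset.card_lt_card (Finset.sdiff_ssubset hGV ⟨i₀, hi₀G⟩)
  have hvan : ∀ v ∈ blockDiagonals H β k (V \ G), eval v h' = 0 := by
    rintro v ⟨S, hSV, hScard, q', hSq, ε, hε, hSv⟩
    -- moving the coordinate `i₀` stays on the diagonal
    have hline : ∀ s : ℂ, eval (Function.update v i₀ s) (∏ a ∈ A, (X a.1 - C a.2 * X i₀)) *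
        eval (Function.update v i₀ s) h' = 0 := by
      intro s
      rw [← map_mul, ← hh', eval_collapseVars]
      refine hv _ ⟨S, hSV.trans Finset.sdiff_subset, hScard, q', hSq, ε, hε, fun i hi j hj => ?_⟩
      have hiG := (Finset.mem_sdiff.1 (hSV hi)).2
      have hjG := (Finset.mem_sdiff.1 (hSV hj)).2
      have hii : i ≠ i₀ := fun h => hiG (h ▸ hi₀G)
      have hjj : j ≠ i₀ := fun h => hjG (h ▸ hi₀G)
      simpa [hiG, hjG, Function.update_of_ne hii, Function.update_of_ne hjj] using hSv i hi j hj
    let φ : MvPolynomial ι ℂ →ₐ[ℂ] Polynomial ℂ :=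
      aeval (Function.update (fun i => Polynomial.C (v i)) i₀ Polynomial.X)
    have hφ : ∀ (p : MvPolynomial ι ℂ) (s : ℂ),
        (φ p).eval s = eval (Function.update v i₀ s) p := by
      intro p s
      have : ((Polynomial.aeval s).comp φ : MvPolynomial ι ℂ →ₐ[ℂ] ℂ) =
          aeval (Function.update v i₀ s) := by
        refine algHom_ext fun i => ?_
        by_cases hi : i = i₀
        · subst hi; simp [φ]
        · simp [φ, Function.update_of_ne hi]
      have h3 := DFunLike.congr_fun this p
      rwa [AlgHom.comp_apply, Polynomial.coe_aeval_eq_eval, aeval_eq_eval] at h3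
    have hprod : φ (∏ a ∈ A, (X a.1 - C a.2 * X i₀)) * φ h' = 0 := by
      refine Polynomial.funext fun s => ?_
      rw [Polynomial.eval_mul, hφ, hφ, hline, Polynomial.eval_zero]
    have hnz : φ (∏ a ∈ A, (X a.1 - C a.2 * X i₀)) ≠ 0 := by
      rw [map_prod, Finset.prod_ne_zero_iff]
      rintro ⟨w, c⟩ ha h3
      have hw := hA0 _ ha
      have hc : c ≠ 0 := by
        rcases hH q c (Finset.mem_product.1 ha).2 with h1 | h1 <;> simp [h1]
      have h4 := congrArg (Polynomial.coeff · 1) h3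
      simp [φ, Function.update_of_ne hw, Polynomial.coeff_C] at h4
      exact hc h4
    have h5 := (mul_eq_zero.1 hprod).resolve_left hnz
    have h6 := hφ h' (v i₀)
    rw [h5, Polynomial.eval_zero, Function.update_eq_self] at h6
    exact h6.symm
  have hrec := ih _ hcard (V \ G) h' hh'0 (fun i hi => hβ i (Finset.sdiff_subset hi)) hvan rfl
  have hqQ : q ∈ Q := hβ i₀ hi₀
  have hBG : (V \ G).filter (fun i => β i = q) = B \ G := by
    ext i; simp [hB]; tauto
  have hother : ∀ q' ∈ Q.erase q, (V \ G).filter (fun i => β i = q') =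
      V.filter fun i => β i = q' := by
    intro q' hq'
    ext i
    simp only [Finset.mem_filter, Finset.mem_sdiff]
    refine ⟨fun hi => ⟨hi.1.1, hi.2⟩, fun hi => ⟨⟨hi.1, fun hiG => ?_⟩, hi.2⟩⟩
    exact Finset.ne_of_mem_erase hq' (hi.2.symm.trans (hGq i hiG))
  rw [← Finset.add_sum_erase _ _ hqQ] at hrec ⊢
  rw [hBG, Finset.sum_congr rfl fun q' hq' => by rw [hother q' hq'], Finset.card_sdiff_of_subset hGB]
    at hrec
  have hstep := collapseOrder_le_add hk hgk (Finset.card_le_card hGB)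
  have hcardA : (A.card : ℝ) = ((B.card - G.card : ℕ) : ℝ) * (H q).card := by
    rw [hA, Finset.card_product, Finset.card_sdiff_of_subset hGB]
    push_cast
    ring
  have hdeg' : (A.card : ℝ) + h'.totalDegree ≤ h.totalDegree := by
    exact_mod_cast hdeg.trans (totalDegree_collapseVars_le _ _ _ _)
  have hm := mul_le_mul_of_nonneg_left hstep (Nat.cast_nonneg (α := ℝ) (H q).card)
  nlinarith

end CollapsingDegree

section GapMonomials

open MvPolynomial

variable {N : ℕ}

/-- The sign groups attached to the blocks: both signs are allowed in block `0` only. -/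
noncomputable def blockSigns (q : ℕ) : Finset ℂ := if q = 0 then {1, -1} else {1}

theorem one_mem_blockSigns (q : ℕ) : 1 ∈ blockSigns q := by
  unfold blockSigns; split_ifs <;> simp

theorem eq_one_or_of_mem_blockSigns (q : ℕ) : ∀ c ∈ blockSigns q, c = 1 ∨ c = -1 := by
  unfold blockSigns; split_ifs <;> simp +contextual

theorem card_blockSigns (q : ℕ) : (blockSigns q).card = if q = 0 then 2 else 1 := by
  unfold blockSigns
  split_ifs
  · exact Finset.card_pair (by norm_num)
  · simp

/-- The substitution `x i ↦ c i + X i * t`, with values in polynomials in `t`. -/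
noncomputable def lineSubst (c : Fin N → ℂ) :
    MvPolynomial (Fin N) ℂ →ₐ[ℂ] Polynomial (MvPolynomial (Fin N) ℂ) :=
  aeval fun i => Polynomial.C (C (c i)) + Polynomial.C (X i) * Polynomial.X

theorem totalDegree_coeff_lineSubst_le (c : Fin N → ℂ) (F : MvPolynomial (Fin N) ℂ) (j : ℕ) :
    ((lineSubst c F).coeff j).totalDegree ≤ j := by
  induction F using MvPolynomial.induction_on generalizing j with
  | C a =>
    have : lineSubst c (C a) = Polynomial.C (C a) := by
      rw [← algebraMap_eq, AlgHom.commutes]; rfl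
    rw [this, Polynomial.coeff_C]
    split_ifs <;> simp
  | add p q hp hq =>
    rw [map_add, Polynomial.coeff_add]
    exact (totalDegree_add _ _).trans (max_le (hp j) (hq j))
  | mul_X p i hp =>
    have : lineSubst c (X i) = Polynomial.C (C (c i)) + Polynomial.C (X i) * Polynomial.X := by
      simp [lineSubst]
    rw [map_mul, this, mul_add, Polynomial.coeff_add, Polynomial.coeff_mul_C, ← mul_assoc]
    refine (totalDegree_add _ _).trans (max_le ?_ ?_)
    · refine (totalDegree_mul _ _).trans ?_
      simpa using hp j
    · cases j with
      | zero => simp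
      | succ j =>
        rw [Polynomial.coeff_mul_X, Polynomial.coeff_mul_C]
        refine (totalDegree_mul _ _).trans ?_
        simpa using hp j

theorem map_eval_lineSubst (c v : Fin N → ℂ) (F : MvPolynomial (Fin N) ℂ) :
    (lineSubst c F).map (eval v) =
      aeval (fun i => Polynomial.C (c i) + Polynomial.C (v i) * Polynomial.X) F := by
  induction F using MvPolynomial.induction_on with
  | C a =>
    have : lineSubst c (C a) = Polynomial.C (C a) := by
      rw [← algebraMap_eq, AlgHom.commutes]; rfl
    rw [this, Polynomial.map_C, eval_C, ← algebraMap_eq, AlgHom.commutes]; rfl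
  | add p q hp hq => simp only [map_add, Polynomial.map_add, hp, hq]
  | mul_X p i hp =>
    rw [map_mul, Polynomial.map_mul, hp, map_mul]
    simp [lineSubst]

theorem eval_aeval_line (c v : Fin N → ℂ) (F : MvPolynomial (Fin N) ℂ) (t : ℂ) :
    (aeval (fun i => Polynomial.C (c i) + Polynomial.C (v i) * Polynomial.X) F :
      Polynomial ℂ).eval t = eval (fun i => c i + v i * t) F := by
  induction F using MvPolynomial.induction_on with
  | C a => rw [← algebraMap_eq, AlgHom.commutes]; simp
  | add p q hp hq => simp only [map_add, Polynomial.eval_add, hp, hq]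
  | mul_X p i hp =>
    rw [map_mul, Polynomial.eval_mul, hp, map_mul]
    simp

/-- The order of vanishing along a block decomposition of a polynomial that vanishes on
`signedDiagonals N k`. -/
theorem coeff_line_eq_zero {k : ℕ} (hk : 1 ≤ k) {F : MvPolynomial (Fin N) ℂ}
    (hF : ∀ x ∈ signedDiagonals N k, eval x F = 0) (β : Fin N → ℕ) (c v : Fin N → ℂ)
    (hc : ∀ i j, β i = β j → c i = c j) (hc0 : ∀ i, β i = 0 → c i = 0) (Q : Finset ℕ)
    (hβ : ∀ i, β i ∈ Q) (j : ℕ)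
    (hj : (j : ℝ) < ∑ q ∈ Q, ((blockSigns q).card : ℝ) *
      collapseOrder k (Finset.univ.filter fun i => β i = q).card) :
    (aeval (fun i => Polynomial.C (c i) + Polynomial.C (v i) * Polynomial.X) F :
      Polynomial ℂ).coeff j = 0 := by
  rw [← map_eval_lineSubst, Polynomial.coeff_map]
  suffices h : (lineSubst c F).coeff j = 0 by rw [h, map_zero]
  by_contra hne
  refine absurd (sum_collapseOrder_le_totalDegree blockSigns eq_one_or_of_mem_blockSigns
    one_mem_blockSigns β hk Q Finset.univ _ hne (fun i _ => hβ i) ?_) (not_le.2 (hj.trans_le' ?_))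
  · rintro w ⟨S, -, hS, q, hSq, ε, hε, hSw⟩
    rw [← Polynomial.coeff_map, map_eval_lineSubst]
    have : (aeval (fun i => Polynomial.C (c i) + Polynomial.C (w i) * Polynomial.X) F :
        Polynomial ℂ) = 0 := by
      refine Polynomial.funext fun t => ?_
      rw [eval_aeval_line, Polynomial.eval_zero]
      refine hF _ ⟨S, hS, ε, fun i => eq_one_or_of_mem_blockSigns q _ (hε i), fun i hi j hj => ?_⟩
      have h1 : ε i * c i = ε j * c j := by
        by_cases hq : q = 0
        · rw [hc0 i (by rw [hSq i hi, hq]), hc0 j (by rw [hSq j hj, hq]), mul_zero, mul_zero]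
        · have h2 : ∀ i, ε i = 1 := fun i => by simpa [blockSigns, hq] using hε i
          rw [h2, h2, hc i j (by rw [hSq i hi, hSq j hj])]
      linear_combination h1 + t * hSw i hi j hj
    rw [this, Polynomial.coeff_zero]
  · exact_mod_cast totalDegree_coeff_lineSubst_le c F j

/-- The polynomial `F` in terms of the gaps `δ`, where `x i = ∑ l ≤ i, δ l`. -/
noncomputable def gapPoly (F : MvPolynomial (Fin N) ℂ) : MvPolynomial (Fin N) ℂ :=
  aeval (fun i => ∑ l ∈ Finset.Iic i, X l) F

theorem eval_gapPoly (F : MvPolynomial (Fin N) ℂ) (d : Fin N → ℂ) :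
    eval d (gapPoly F) = eval (fun i => ∑ l ∈ Finset.Iic i, d l) F := by
  rw [gapPoly, aeval_def, eval_eval₂, eval]
  congr 1
  · ext; simp
  · funext i
    simp

/-- The block of `i` when the gaps in `T` are collapsed. -/
def gapBlock (T : Finset (Fin N)) (i : Fin N) : ℕ := ((Finset.Iic i).filter fun l => l ∉ T).card

theorem gapBlock_eq_zero_iff {T : Finset (Fin N)} {i : Fin N} :
    gapBlock T i = 0 ↔ Finset.Iic i ⊆ T := by
  rw [gapBlock, Finset.card_eq_zero, Finset.filter_eq_empty_iff]
  simp [Finset.subset_iff]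

theorem gapBlock_eq_iff {T : Finset (Fin N)} {i j : Fin N} (hij : i ≤ j) :
    gapBlock T i = gapBlock T j ↔ Finset.Ioc i j ⊆ T := by
  have hsub : (Finset.Iic i).filter (fun l => l ∉ T) ⊆ (Finset.Iic j).filter fun l => l ∉ T :=
    Finset.filter_subset_filter _ (Finset.Iic_subset_Iic.2 hij)
  constructor
  · intro h l hl
    by_contra hlT
    have h1 := Finset.eq_of_subset_of_card_le hsub h.ge
    rw [Finset.mem_Ioc] at hl
    have h2 : l ∈ (Finset.Iic i).filter fun l => l ∉ T := by
      rw [h1]; simp [hl.2, hlT]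
    simp only [Finset.mem_filter, Finset.mem_Iic] at h2
    exact absurd h2.1 (not_le.2 hl.1)
  · intro h
    refine congrArg Finset.card (hsub.antisymm fun l hl => ?_)
    simp only [Finset.mem_filter, Finset.mem_Iic] at hl ⊢
    refine ⟨?_, hl.2⟩
    by_contra! hil
    exact hl.2 (h (Finset.mem_Ioc.2 ⟨hil, hl.1⟩))

theorem sum_Iic_filter_notMem_eq {T : Finset (Fin N)} (d : Fin N → ℂ) {i j : Fin N}
    (h : gapBlock T i = gapBlock T j) :
    ∑ l ∈ (Finset.Iic i).filter (fun l => l ∉ T), d l =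
      ∑ l ∈ (Finset.Iic j).filter (fun l => l ∉ T), d l := by
  wlog hij : i ≤ j generalizing i j
  · exact (this h.symm (le_of_not_ge hij)).symm
  congr 1
  exact Finset.eq_of_subset_of_card_le
    (Finset.filter_subset_filter _ (Finset.Iic_subset_Iic.2 hij)) h.ge

/-- If the part of degree `j` in the variables of `T` vanishes identically, there are no monomials
of degree `j` in these variables. -/
theorem sum_ne_of_mem_support (P : MvPolynomial (Fin N) ℂ) (T : Finset (Fin N)) (j : ℕ)
    (h : ∀ d : Fin N → ℂ, (aeval (fun l => Polynomial.C (d l) *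
      Polynomial.X ^ (if l ∈ T then 1 else 0)) P : Polynomial ℂ).coeff j = 0)
    {a : Fin N →₀ ℕ} (ha : a ∈ P.support) : ∑ l ∈ T, a l ≠ j := by
  classical
  intro haj
  let P' : MvPolynomial (Fin N) ℂ :=
    ∑ s ∈ P.support, if ∑ l ∈ T, s l = j then monomial s (coeff s P) else 0
  have hP' : P' = 0 := by
    refine MvPolynomial.funext fun d => ?_
    rw [map_zero, ← h d, aeval_def, eval₂_eq', Polynomial.finsetSum_coeff]
    simp only [P', map_sum]
    refine Finset.sum_congr rfl fun s _ => ?_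
    have h1 : (algebraMap ℂ (Polynomial ℂ) (coeff s P) * ∏ i, (Polynomial.C (d i) *
        Polynomial.X ^ (if i ∈ T then 1 else 0)) ^ s i : Polynomial ℂ) =
        Polynomial.C (coeff s P * ∏ i, d i ^ s i) * Polynomial.X ^ (∑ l ∈ T, s l) := by
      simp only [mul_pow, Finset.prod_mul_distrib, ← pow_mul, Finset.prod_pow_eq_pow_sum]
      simp [Polynomial.algebraMap_eq, mul_assoc, Finset.sum_ite_mem]
    rw [h1, Polynomial.coeff_C_mul, Polynomial.coeff_X_pow]
    by_cases hs : ∑ l ∈ T, s l = j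
    · simp [hs, eval_monomial, Finsupp.prod_fintype]
    · simp [hs, Ne.symm hs]
  have h2 : coeff a P' = coeff a P := by
    simp only [P', coeff_sum]
    rw [Finset.sum_eq_single a]
    · simp [haj]
    · intro b _ hb
      split_ifs
      · rw [coeff_monomial, if_neg hb]
      · simp
    · exact fun h => absurd ha h
  rw [hP', coeff_zero] at h2
  exact (mem_support_iff.1 ha) h2.symm

theorem collapseOrder_le_sum_of_mem_support {k : ℕ} (hk : 1 ≤ k) {F : MvPolynomial (Fin N) ℂ}
    (hF : ∀ x ∈ signedDiagonals N k, eval x F = 0) (T : Finset (Fin N)) (Q : Finset ℕ)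
    (hQ : ∀ i, gapBlock T i ∈ Q) {a : Fin N →₀ ℕ} (ha : a ∈ (gapPoly F).support) :
    ∑ q ∈ Q, ((blockSigns q).card : ℝ) *
      collapseOrder k (Finset.univ.filter fun i => gapBlock T i = q).card ≤ ∑ l ∈ T, (a l : ℝ) := by
  by_contra! hlt
  rw [← Nat.cast_sum] at hlt
  refine sum_ne_of_mem_support (gapPoly F) T _ (fun d => ?_) ha rfl
  have key := coeff_line_eq_zero hk hF (gapBlock T)
    (fun i => ∑ l ∈ (Finset.Iic i).filter (fun l => l ∉ T), d l)
    (fun i => ∑ l ∈ (Finset.Iic i).filter (fun l => l ∈ T), d l)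
    (fun i j hij => sum_Iic_filter_notMem_eq d hij) (fun i hi => ?_) Q hQ _ hlt
  · rw [← key]
    congr 1
    rw [gapPoly, ← AlgHom.comp_apply]
    congr 1
    refine algHom_ext fun i => ?_
    rw [AlgHom.comp_apply, aeval_X, aeval_X, map_sum,
      ← Finset.sum_filter_add_sum_filter_not (Finset.Iic i) (fun l => l ∈ T), add_comm, map_sum,
      map_sum, Finset.sum_mul]
    congr 1
    · refine Finset.sum_congr rfl fun l hl => ?_
      simp [(Finset.mem_filter.1 hl).2]
    · refine Finset.sum_congr rfl fun l hl => ?_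
      simp [(Finset.mem_filter.1 hl).2]
  · rw [gapBlock, Finset.card_eq_zero] at hi
    rw [hi, Finset.sum_empty]

end GapMonomials

section LayerCake

variable {ι κ : Type*} [Fintype ι] [Fintype κ] [DecidableEq κ]

theorem setIntegral_Ioc_indicator_Iic {m B : ℝ} (hm : 0 ≤ m) (hB : m ≤ B) :
    ∫ θ in Set.Ioc 0 B, (Set.Iic m).indicator (fun _ => (1 : ℝ)) θ = m := by
  rw [integral_indicator measurableSet_Iic, Measure.restrict_restrict measurableSet_Iic]
  have : Set.Iic m ∩ Set.Ioc 0 B = Set.Ioc 0 m := by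
    ext x
    simp only [Set.mem_inter_iff, Set.mem_Iic, Set.mem_Ioc]
    exact ⟨fun h => ⟨h.2.1, h.1⟩, fun h => ⟨h.2, h.1, h.2.trans hB⟩⟩
  rw [this]
  simp [hm]

/-- A linear combination of minima over sets `S j` is nonnegative on the positive orthant as soon
as it is nonnegative on indicator functions. -/
theorem sum_mul_inf'_add_nonneg (S : ι → Finset κ) (hS : ∀ j, (S j).Nonempty) (α : ι → ℝ) (γ : ℝ)
    (h : ∀ T : Finset κ, T.Nonempty → 0 ≤ (∑ j, if S j ⊆ T then α j else 0) + γ * T.card)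
    (L : κ → ℝ) (hL : ∀ l, 0 ≤ L l) :
    0 ≤ ∑ j, α j * (S j).inf' (hS j) L + γ * ∑ l, L l := by
  set B := ∑ l, L l with hB
  have hLB : ∀ l, L l ≤ B := fun l =>
    Finset.single_le_sum (f := L) (fun i _ => hL i) (Finset.mem_univ l)
  have hm0 : ∀ j, 0 ≤ (S j).inf' (hS j) L := fun j => Finset.le_inf' _ _ fun l _ => hL l
  have hmB : ∀ j, (S j).inf' (hS j) L ≤ B := fun j => by
    obtain ⟨l, hl⟩ := hS j
    exact (Finset.inf'_le _ hl).trans (hLB l)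
  have hint : ∀ m : ℝ, Integrable ((Set.Iic m).indicator fun _ => (1 : ℝ))
      (volume.restrict (Set.Ioc 0 B)) := fun m =>
    (integrable_const _).indicator measurableSet_Iic
  have key : ∑ j, α j * (S j).inf' (hS j) L + γ * ∑ l, L l =
      ∫ θ in Set.Ioc 0 B, (∑ j, α j * (Set.Iic ((S j).inf' (hS j) L)).indicator (fun _ => 1) θ +
        γ * ∑ l, (Set.Iic (L l)).indicator (fun _ => 1) θ) := by
    rw [integral_add (integrable_finsetSum _ fun j _ => (hint _).const_mul _)
      ((integrable_finsetSum _ fun j _ => hint _).const_mul _), integral_const_mul,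
      integral_finsetSum _ fun j _ => (hint _).const_mul _, integral_finsetSum _ fun j _ => hint _]
    congr 1
    · refine Finset.sum_congr rfl fun j _ => ?_
      rw [integral_const_mul, setIntegral_Ioc_indicator_Iic (hm0 j) (hmB j)]
    · rw [Finset.sum_congr rfl fun l _ => setIntegral_Ioc_indicator_Iic (hL l) (hLB l)]
  rw [key]
  refine integral_nonneg fun θ => ?_
  set T : Finset κ := Finset.univ.filter fun l => θ ≤ L l with hT
  have h1 : ∀ j, α j * (Set.Iic ((S j).inf' (hS j) L)).indicator (fun _ => 1) θ =
      if S j ⊆ T then α j else 0 := by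
    intro j
    have : S j ⊆ T ↔ θ ≤ (S j).inf' (hS j) L := by
      rw [Finset.le_inf'_iff]
      simp [Finset.subset_iff, hT]
    by_cases hj : S j ⊆ T
    · rw [if_pos hj, Set.indicator_of_mem (Set.mem_Iic.2 (this.1 hj)), mul_one]
    · rw [if_neg hj, Set.indicator_of_notMem (fun h => hj (this.2 (Set.mem_Iic.1 h))), mul_zero]
  have h2 : ∑ l, (Set.Iic (L l)).indicator (fun _ => (1 : ℝ)) θ = T.card := by
    simp [Set.indicator_apply, hT]
  simp only [h1, h2, Pi.zero_apply]
  rcases T.eq_empty_or_nonempty with h0 | h0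
  · rw [h0]
    simp [Finset.subset_empty, (hS _).ne_empty]
  · exact h T h0

end LayerCake

section SectorBound

theorem rpow_le_of_le_mul {w z n : ℝ} (hw : 0 < w) (hwz : w ≤ z) (hn : 1 ≤ n) (hz : z ≤ n * w)
    (p : ℝ) : z ^ p ≤ n ^ |p| * w ^ p := by
  rcases le_or_gt 0 p with hp | hp
  · rw [abs_of_nonneg hp, ← Real.mul_rpow (by linarith) hw.le]
    exact Real.rpow_le_rpow (hw.le.trans hwz) hz hp
  · calc z ^ p ≤ w ^ p := Real.rpow_le_rpow_of_nonpos hw hwz hp.le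
      _ ≤ n ^ |p| * w ^ p := le_mul_of_one_le_left (Real.rpow_nonneg hw.le _)
          (Real.one_le_rpow hn (abs_nonneg _))

theorem exists_prod_rpow_le {ι κ : Type*} [Fintype ι] [Fintype κ] [DecidableEq κ]
    (S : ι → Finset κ) (hS : ∀ j, (S j).Nonempty) (α : ι → ℝ)
    (h : ∀ T : Finset κ, T.Nonempty → 0 < (∑ j, if S j ⊆ T then α j else 0) + T.card) :
    ∃ ε : ℝ, 0 < ε ∧ ε < 1 ∧ ∀ R : ℝ, 0 < R → ∃ C : ℝ, 0 < C ∧ ∀ d : κ → ℝ,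
      (∀ l, 0 < d l ∧ d l ≤ R) → ∏ j, (∑ l ∈ S j, d l) ^ α j ≤ C * ∏ l, d l ^ (ε - 1) := by
  have hε : ∃ ε : ℝ, 0 < ε ∧ ε < 1 ∧ ∀ T : Finset κ, T.Nonempty →
      0 ≤ (∑ j, if S j ⊆ T then α j else 0) + (1 - ε) * T.card := by
    have h1 : ∀ᶠ ε : ℝ in 𝓝[>] 0, ∀ T : Finset κ, T.Nonempty →
        0 ≤ (∑ j, if S j ⊆ T then α j else 0) + (1 - ε) * T.card := by
      rw [Filter.eventually_all]
      intro T
      by_cases hT : T.Nonempty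
      · have hc : Filter.Tendsto (fun ε : ℝ => (∑ j, if S j ⊆ T then α j else 0) +
            (1 - ε) * T.card) (𝓝[>] 0) (𝓝 ((∑ j, if S j ⊆ T then α j else 0) +
            (1 - 0) * T.card)) := by
          refine Filter.Tendsto.mono_left (Continuous.tendsto ?_ _) nhdsWithin_le_nhds
          fun_prop
        have hpos := h T hT
        filter_upwards [hc.eventually (lt_mem_nhds (a := 0) (by simpa using hpos))] with ε hε _
        exact hε.le
      · exact Filter.Eventually.of_forall fun ε hT' => absurd hT' hT
    obtain ⟨ε, h2, h3⟩ := (h1.and (Ioo_mem_nhdsGT (zero_lt_one (α := ℝ)))).exists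
    exact ⟨ε, h3.1, h3.2, h2⟩
  obtain ⟨ε, hε0, hε1, hT⟩ := hε
  refine ⟨ε, hε0, hε1, fun R hR => ?_⟩
  set n : ℝ := Fintype.card κ + 1 with hn
  have hn1 : 1 ≤ n := by simp [hn]
  refine ⟨(∏ j, n ^ |α j| * R ^ α j) * ∏ _l : κ, R ^ (1 - ε), by positivity, fun d hd => ?_⟩
  set L : κ → ℝ := fun l => Real.log R - Real.log (d l) with hLdef
  have hL : ∀ l, 0 ≤ L l := fun l => sub_nonneg.2 (Real.log_le_log (hd l).1 (hd l).2)
  have hdL : ∀ l, d l = R * Real.exp (-L l) := fun l => by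
    simp only [hLdef, neg_sub]
    rw [Real.exp_sub, Real.exp_log hR, Real.exp_log (hd l).1]
    field_simp
  have key := sum_mul_inf'_add_nonneg S hS α (1 - ε) hT L hL
  have hj : ∀ j, (∑ l ∈ S j, d l) ^ α j ≤
      n ^ |α j| * R ^ α j * Real.exp (-(α j * (S j).inf' (hS j) L)) := by
    intro j
    have hw : 0 < R * Real.exp (-(S j).inf' (hS j) L) := by positivity
    have hdw : ∀ l ∈ S j, d l ≤ R * Real.exp (-(S j).inf' (hS j) L) := fun l hl => by
      rw [hdL l]
      gcongr
      exact Finset.inf'_le _ hl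
    refine (rpow_le_of_le_mul hw ?_ hn1 ?_ (α j)).trans_eq ?_
    · obtain ⟨l, hl, hl'⟩ := Finset.exists_mem_eq_inf' (hS j) L
      rw [hl', ← hdL]
      exact Finset.single_le_sum (f := d) (fun i _ => (hd i).1.le) hl
    · refine (Finset.sum_le_card_nsmul _ _ _ hdw).trans ?_
      rw [nsmul_eq_mul]
      gcongr
      rw [hn]
      have : ((S j).card : ℝ) ≤ Fintype.card κ := by exact_mod_cast Finset.card_le_univ _
      linarith
    · rw [Real.mul_rpow hR.le (Real.exp_pos _).le, ← Real.exp_mul, mul_assoc]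
      congr 3
      ring
  have hl : ∀ l, d l ^ (ε - 1) = R ^ (ε - 1) * Real.exp ((1 - ε) * L l) := fun l => by
    rw [hdL l, Real.mul_rpow hR.le (Real.exp_pos _).le, ← Real.exp_mul]
    congr 2
    ring
  calc ∏ j, (∑ l ∈ S j, d l) ^ α j
      ≤ ∏ j, n ^ |α j| * R ^ α j * Real.exp (-(α j * (S j).inf' (hS j) L)) :=
        Finset.prod_le_prod (fun j _ => Real.rpow_nonneg
          (Finset.sum_nonneg fun l _ => (hd l).1.le) _) fun j _ => hj j
    _ = (∏ j, n ^ |α j| * R ^ α j) * Real.exp (-∑ j, α j * (S j).inf' (hS j) L) := by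
        rw [Finset.prod_mul_distrib, ← Finset.sum_neg_distrib, Real.exp_sum]
    _ ≤ (∏ j, n ^ |α j| * R ^ α j) * Real.exp ((1 - ε) * ∑ l, L l) := by
        gcongr
        linarith
    _ = (∏ j, n ^ |α j| * R ^ α j) * ∏ l, (R ^ (1 - ε) * d l ^ (ε - 1)) := by
        rw [Finset.mul_sum, Real.exp_sum]
        congr 1
        refine Finset.prod_congr rfl fun l _ => ?_
        rw [hl, ← mul_assoc, ← Real.rpow_add hR]
        simp
    _ = _ := by rw [Finset.prod_mul_distrib (f := fun _ => R ^ (1 - ε)), ← mul_assoc]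

variable {N : ℕ}

/-- The pairs of indices `i < j`. -/
def orderedPairs (N : ℕ) : Finset (Fin N × Fin N) := Finset.univ.filter fun p => p.1 < p.2

@[to_additive]
theorem prod_prod_Ioi_eq {M : Type*} [CommMonoid M] (g : Fin N → Fin N → M) :
    ∏ i, ∏ j ∈ Finset.Ioi i, g i j = ∏ p ∈ orderedPairs N, g p.1 p.2 := by
  rw [orderedPairs, Finset.prod_filter, ← Finset.univ_product_univ, Finset.prod_product]
  refine Finset.prod_congr rfl fun i _ => ?_
  rw [← Finset.prod_filter]
  congr 1
  ext j
  simp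

/-- The exponent of scale attached to collapsing the gaps in `T`. -/
noncomputable def scaleExponent (a : ℝ) (b γ : Fin N → ℝ) (T : Finset (Fin N)) : ℝ :=
  (∑ p ∈ orderedPairs N, if gapBlock T p.1 = gapBlock T p.2 then a else 0) +
    ((∑ p ∈ orderedPairs N, if gapBlock T p.2 = 0 then a else 0) +
      ((∑ i, if gapBlock T i = 0 then b i else 0) + ∑ l ∈ T, γ l)) + T.card

theorem exists_density_le (a : ℝ) (b γ : Fin N → ℝ)
    (h : ∀ T : Finset (Fin N), T.Nonempty → 0 < scaleExponent a b γ T) :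
    ∃ ε : ℝ, 0 < ε ∧ ε < 1 ∧ ∀ R : ℝ, 0 < R → ∃ C : ℝ, 0 < C ∧ ∀ d t : Fin N → ℝ,
      (∀ l, 0 < d l ∧ d l ≤ R) → (∀ i, t i = ∑ l ∈ Finset.Iic i, d l) →
      (∏ i, ∏ j ∈ Finset.Ioi i, |t i ^ 2 - t j ^ 2| ^ a) * ((∏ i, t i ^ b i) * ∏ l, d l ^ γ l) ≤
        C * ∏ l, d l ^ (ε - 1) := by
  let Pr := {p : Fin N × Fin N // p.1 < p.2}
  have hPr : ∀ p : Fin N × Fin N, p ∈ orderedPairs N ↔ p.1 < p.2 := by simp [orderedPairs]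
  have hsum : ∀ g : Fin N × Fin N → ℝ, ∑ p ∈ orderedPairs N, g p = ∑ p : Pr, g p.1 := fun g =>
    Finset.sum_subtype _ hPr g
  have hprod : ∀ g : Fin N × Fin N → ℝ, ∏ p ∈ orderedPairs N, g p = ∏ p : Pr, g p.1 := fun g =>
    Finset.prod_subtype _ hPr g
  obtain ⟨ε, hε0, hε1, hR⟩ := exists_prod_rpow_le (ι := Pr ⊕ (Pr ⊕ (Fin N ⊕ Fin N))) (κ := Fin N)
    (Sum.elim (fun p => Finset.Ioc p.1.1 p.1.2) (Sum.elim (fun p => Finset.Iic p.1.2)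
      (Sum.elim (fun i => Finset.Iic i) fun l => {l}))) (by
        rintro (p | p | i | l)
        · simpa using p.2
        · simp
        · simp
        · simp)
    (Sum.elim (fun _ => a) (Sum.elim (fun _ => a) (Sum.elim b γ))) (by
      intro T hT
      refine (h T hT).trans_eq ?_
      simp only [Fintype.sum_sum_type, Sum.elim_inl, Sum.elim_inr, scaleExponent]
      rw [hsum, hsum]
      congr 2
      · exact Finset.sum_congr rfl fun p _ => if_congr (gapBlock_eq_iff p.2.le) rfl rfl
      · congr 1
        · exact Finset.sum_congr rfl fun p _ => if_congr gapBlock_eq_zero_iff rfl rfl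
        · congr 1
          · exact Finset.sum_congr rfl fun p _ => if_congr gapBlock_eq_zero_iff rfl rfl
          · simp only [Finset.singleton_subset_iff, Finset.sum_ite_mem, Finset.univ_inter])
  refine ⟨ε, hε0, hε1, fun R hR0 => ?_⟩
  obtain ⟨C, hC, hd⟩ := hR R hR0
  refine ⟨(∏ _p : Pr, 2 ^ |a|) * C, by positivity, fun d t hdR ht => ?_⟩
  have hd0 := hd d hdR
  simp only [Fintype.prod_sum_type, Sum.elim_inl, Sum.elim_inr, Finset.sum_singleton, ← ht] at hd0
  have htpos : ∀ i, 0 < t i := fun i => by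
    rw [ht]
    exact Finset.sum_pos (fun l _ => (hdR l).1) ⟨i, by simp⟩
  have hsub : ∀ p : Pr, ∑ l ∈ Finset.Ioc p.1.1 p.1.2, d l = t p.1.2 - t p.1.1 := by
    intro p
    rw [ht, ht, eq_sub_iff_add_eq, add_comm, ← Finset.sum_union]
    · congr 1
      ext l
      simp only [Finset.mem_union, Finset.mem_Iic, Finset.mem_Ioc]
      have := p.2
      constructor
      · rintro (h | h)
        · exact h.trans this.le
        · exact h.2
      · intro h
        rcases le_or_gt l p.1.1 with h' | h'
        · exact Or.inl h'
        · exact Or.inr ⟨h', h⟩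
    · rw [Finset.disjoint_left]
      intro l hl hl'
      simp only [Finset.mem_Iic, Finset.mem_Ioc] at hl hl'
      exact absurd hl (not_le.2 hl'.1)
  have hpos : ∀ p : Pr, 0 < t p.1.2 - t p.1.1 := fun p => by
    rw [← hsub]
    exact Finset.sum_pos (fun l _ => (hdR l).1) ⟨p.1.2, by simpa using p.2⟩
  have hpair : ∏ i, ∏ j ∈ Finset.Ioi i, |t i ^ 2 - t j ^ 2| ^ a ≤
      (∏ _p : Pr, (2 : ℝ) ^ |a|) * ((∏ p : Pr, (∑ l ∈ Finset.Ioc p.1.1 p.1.2, d l) ^ a) *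
        ∏ p : Pr, t p.1.2 ^ a) := by
    rw [prod_prod_Ioi_eq (fun i j => |t i ^ 2 - t j ^ 2| ^ a),
      hprod, ← Finset.prod_mul_distrib,
      ← Finset.prod_mul_distrib]
    refine Finset.prod_le_prod (fun p _ => by positivity) fun p _ => ?_
    have h1 := hpos p
    have h2 := htpos p.1.1
    have h3 := htpos p.1.2
    have h4 : |t p.1.1 ^ 2 - t p.1.2 ^ 2| = (t p.1.2 - t p.1.1) * (t p.1.2 + t p.1.1) := by
      rw [abs_sub_comm, abs_of_nonneg (by nlinarith)]
      ring
    rw [h4, Real.mul_rpow h1.le (by linarith), hsub]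
    have := rpow_le_of_le_mul (n := 2) h3 (by linarith : t p.1.2 ≤ t p.1.2 + t p.1.1) (by norm_num)
      (by linarith) a
    calc _ ≤ (t p.1.2 - t p.1.1) ^ a * (2 ^ |a| * t p.1.2 ^ a) := by gcongr
      _ = _ := by ring
  have hrest : 0 ≤ (∏ i, t i ^ b i) * ∏ l, d l ^ γ l :=
    mul_nonneg (Finset.prod_nonneg fun i _ => Real.rpow_nonneg (htpos i).le _)
      (Finset.prod_nonneg fun l _ => Real.rpow_nonneg (hdR l).1.le _)
  calc _ ≤ _ := mul_le_mul_of_nonneg_right hpair hrest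
    _ = (∏ _p : Pr, (2 : ℝ) ^ |a|) * ((∏ p : Pr, (∑ l ∈ Finset.Ioc p.1.1 p.1.2, d l) ^ a) *
        ((∏ p : Pr, t p.1.2 ^ a) * ((∏ i, t i ^ b i) * ∏ l, d l ^ γ l))) := by ring
    _ ≤ (∏ _p : Pr, (2 : ℝ) ^ |a|) * (C * ∏ l, d l ^ (ε - 1)) := by gcongr
    _ = _ := by rw [mul_assoc]

end SectorBound

section ChainIntegral

open scoped ENNReal

/-- The kernel `||u| - c| ^ e` cut off to `[-R, R]`. -/
noncomputable def chainKernel (e R c u : ℝ) : ℝ≥0∞ :=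
  (Set.Icc (-R) R).indicator (fun u => ENNReal.ofReal |(|u| - c)| ^ e) u

theorem measurable_chainKernel (e R : ℝ) :
    Measurable fun p : ℝ × ℝ => chainKernel e R p.1 p.2 := by
  have : (fun p : ℝ × ℝ => chainKernel e R p.1 p.2) = (Prod.snd ⁻¹' Set.Icc (-R) R).indicator
      fun p : ℝ × ℝ => ENNReal.ofReal |(|p.2| - p.1)| ^ e := by
    ext p
    by_cases hp : p.2 ∈ Set.Icc (-R) R
    · rw [chainKernel, Set.indicator_of_mem hp, Set.indicator_of_mem (s := Prod.snd ⁻¹' _) hp]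
    · rw [chainKernel, Set.indicator_of_notMem hp,
        Set.indicator_of_notMem (s := Prod.snd ⁻¹' _) hp]
  rw [this]
  refine Measurable.indicator ?_ (measurable_snd measurableSet_Icc)
  fun_prop

theorem lintegral_abs_rpow_lt_top {e : ℝ} (he : -1 < e) :
    ∫⁻ v, (Set.Icc (-1 : ℝ) 1).indicator (fun v => ENNReal.ofReal |v| ^ e) v < ∞ := by
  set G : ℝ → ℝ≥0∞ := (Set.Ioc (0 : ℝ) 1).indicator fun v => ENNReal.ofReal (v ^ e) with hG
  have hGm : Measurable G := by
    refine Measurable.indicator ?_ measurableSet_Ioc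
    fun_prop
  have hGfin : ∫⁻ v, G v < ∞ := by
    rw [hG, lintegral_indicator measurableSet_Ioc]
    have h1 := (intervalIntegrable_iff_integrableOn_Ioc_of_le zero_le_one).1
      (intervalIntegral.intervalIntegrable_rpow' (a := 0) (b := 1) he)
    refine lt_of_le_of_lt (lintegral_mono fun v => ?_) h1.2
    exact Real.ofReal_le_enorm _
  have hle : ∀ᵐ v : ℝ, (Set.Icc (-1 : ℝ) 1).indicator (fun v => ENNReal.ofReal |v| ^ e) v ≤
      G v + G (-v) := by
    have h0 : ∀ᵐ v : ℝ, v ≠ 0 := by simp [ae_iff]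
    filter_upwards [h0] with v hv
    rw [Set.indicator_apply]
    split_ifs with hv1
    · rw [ENNReal.ofReal_rpow_of_pos (abs_pos.2 hv)]
      rcases lt_or_gt_of_ne hv with h | h
      · refine le_trans ?_ le_add_self
        rw [hG, Set.indicator_of_mem (by simp only [Set.mem_Ioc, Set.mem_Icc] at hv1 ⊢; constructor <;> linarith),
          abs_of_neg h]
      · refine le_trans ?_ le_self_add
        rw [hG, Set.indicator_of_mem (Set.mem_Ioc.2 ⟨h, hv1.2⟩), abs_of_pos h]
    · exact zero_le
  refine (lintegral_mono_ae hle).trans_lt ?_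
  rw [lintegral_add_left hGm, lintegral_neg_eq_self (μ := volume) G]
  exact ENNReal.add_lt_top.2 ⟨hGfin, hGfin⟩

theorem exists_lintegral_chainKernel_le {e : ℝ} (he : -1 < e) (he0 : e < 0) (R : ℝ) :
    ∃ K : ℝ≥0∞, K < ∞ ∧ ∀ c, ∫⁻ u, chainKernel e R c u ≤ K := by
  set g : ℝ → ℝ≥0∞ := (Set.Icc (-1 : ℝ) 1).indicator fun v => ENNReal.ofReal |v| ^ e with hg
  set b : ℝ → ℝ≥0∞ := (Set.Icc (-R) R).indicator fun _ => 1 with hb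
  have hbm : Measurable b := measurable_const.indicator measurableSet_Icc
  have hgm : Measurable g := by
    refine Measurable.indicator ?_ measurableSet_Icc
    fun_prop
  have hbfin : ∫⁻ u, b u < ∞ := by
    rw [hb, lintegral_indicator measurableSet_Icc]
    simp
  have hone : ∀ v, ENNReal.ofReal |v| ^ e ≤ 1 + g v := by
    intro v
    by_cases hv : v ∈ Set.Icc (-1 : ℝ) 1
    · rw [hg, Set.indicator_of_mem hv]
      exact le_add_self
    · refine le_trans ?_ le_self_add
      refine ENNReal.rpow_le_one_of_one_le_of_neg ?_ he0
      rw [ENNReal.one_le_ofReal]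
      by_contra! h
      exact hv (abs_le.1 h.le)
  refine ⟨(∫⁻ u, b u) + ((∫⁻ u, g u) + ∫⁻ u, g u), ?_, fun c => ?_⟩
  · have := lintegral_abs_rpow_lt_top he
    exact ENNReal.add_lt_top.2 ⟨hbfin, ENNReal.add_lt_top.2 ⟨this, this⟩⟩
  · have hle : ∀ u, chainKernel e R c u ≤ b u + (g (u - c) + g (u + c)) := by
      intro u
      rw [chainKernel, Set.indicator_apply]
      split_ifs with hu
      · rw [hb, Set.indicator_of_mem hu]
        rcases abs_cases u with ⟨h, -⟩ | ⟨h, -⟩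
        · rw [h]
          refine (hone _).trans ?_
          gcongr
          exact le_self_add
        · rw [h, ← neg_add', abs_neg]
          refine (hone _).trans ?_
          gcongr
          exact le_add_self
      · exact zero_le
    refine (lintegral_mono hle).trans_eq ?_
    rw [lintegral_add_left hbm, lintegral_add_left (f := fun u => g (u - c)) (hgm.comp (measurable_sub_const c)),
      lintegral_sub_right_eq_self g c, lintegral_add_right_eq_self g c]

/-- The product of the kernels along the chain `c, |x 0|, |x 1|, …`. -/
noncomputable def chainWeight {n : ℕ} (e R c : ℝ) (x : Fin n → ℝ) : ℝ≥0∞ :=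
  ∏ l, chainKernel e R ((Fin.cons c fun i => |x i| : Fin (n + 1) → ℝ) l.castSucc) (x l)

theorem chainWeight_succ {n : ℕ} (e R c : ℝ) (x : Fin (n + 1) → ℝ) :
    chainWeight e R c x = chainKernel e R c (x 0) * chainWeight e R |x 0| (Fin.tail x) := by
  rw [chainWeight, Fin.prod_univ_succ]
  congr 1
  refine Finset.prod_congr rfl fun l _ => ?_
  congr 1
  rw [← Fin.succ_castSucc, Fin.cons_succ]
  generalize l.castSucc = m
  cases m using Fin.cases with
  | zero => rfl
  | succ m => rfl

theorem measurable_chainWeight {n : ℕ} (e R c : ℝ) :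
    Measurable (chainWeight e R c : (Fin n → ℝ) → ℝ≥0∞) := by
  unfold chainWeight
  refine Finset.measurable_prod _ fun l _ => ?_
  have : Measurable fun x : Fin n → ℝ =>
      (((Fin.cons c fun i => |x i| : Fin (n + 1) → ℝ) l.castSucc), x l) := by
    refine Measurable.prodMk ?_ (measurable_pi_apply l)
    generalize l.castSucc = m
    cases m using Fin.cases with
    | zero => simp
    | succ m => simp only [Fin.cons_succ]; fun_prop
  exact (measurable_chainKernel e R).comp this

theorem lintegral_chainWeight_le {e R : ℝ} {K : ℝ≥0∞} (hK : ∀ c, ∫⁻ u, chainKernel e R c u ≤ K)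
    (n : ℕ) (c : ℝ) : ∫⁻ x : Fin n → ℝ, chainWeight e R c x ≤ K ^ n := by
  induction n generalizing c with
  | zero => simp [chainWeight, volume_pi]
  | succ n ih =>
    have hmp := (volume_preserving_piFinSuccAbove (fun _ : Fin (n + 1) => ℝ) 0).symm
    rw [← hmp.lintegral_comp (measurable_chainWeight e R c)]
    have heq : ∀ p : ℝ × (Fin n → ℝ), chainWeight e R c
        ((MeasurableEquiv.piFinSuccAbove (fun _ : Fin (n + 1) => ℝ) 0).symm p) =
        chainKernel e R c p.1 * chainWeight e R |p.1| p.2 := by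
      intro p
      rw [chainWeight_succ]
      simp [MeasurableEquiv.piFinSuccAbove]
      rfl
    have hm : Measurable fun p : ℝ × (Fin n → ℝ) => chainWeight e R c
        ((MeasurableEquiv.piFinSuccAbove (fun _ : Fin (n + 1) => ℝ) 0).symm p) :=
      (measurable_chainWeight e R c).comp (MeasurableEquiv.measurable _)
    rw [Measure.volume_eq_prod, lintegral_prod _ hm.aemeasurable]
    simp only [heq]
    calc ∫⁻ u, ∫⁻ x, chainKernel e R c u * chainWeight e R |u| x
        = ∫⁻ u, chainKernel e R c u * ∫⁻ x : Fin n → ℝ, chainWeight e R |u| x := by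
          refine lintegral_congr fun u => ?_
          rw [lintegral_const_mul _ (measurable_chainWeight e R _)]
      _ ≤ ∫⁻ u, chainKernel e R c u * K ^ n := by
          gcongr with u
          exact ih _
      _ = (∫⁻ u, chainKernel e R c u) * K ^ n := by
          rw [lintegral_mul_const]
          exact (measurable_chainKernel e R).comp (measurable_const.prodMk measurable_id)
      _ ≤ K ^ (n + 1) := by
          rw [pow_succ, mul_comm]
          gcongr
          exact hK c

theorem lintegral_chainWeight_lt_top {e : ℝ} (he : -1 < e) (he0 : e < 0) (R : ℝ) (n : ℕ) (c : ℝ) :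
    ∫⁻ x : Fin n → ℝ, chainWeight e R c x < ∞ := by
  obtain ⟨K, hK, hKc⟩ := exists_lintegral_chainKernel_le he he0 R
  exact (lintegral_chainWeight_le hKc n c).trans_lt (ENNReal.pow_lt_top hK)

end ChainIntegral

section LocalIntegrability

open scoped ENNReal

variable {N : ℕ}

theorem prod_Ioi_comp_perm (σ : Equiv.Perm (Fin N)) {w : Fin N → Fin N → ℝ}
    (h0 : ∀ i j, 0 ≤ w i j) (hw : ∀ i j, w i j = w j i) :
    ∏ i, ∏ j ∈ Finset.Ioi i, w (σ i) (σ j) = ∏ i, ∏ j ∈ Finset.Ioi i, w i j := by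
  have hsq : ∀ w : Fin N → Fin N → ℝ, (∀ i j, w i j = w j i) →
      (∏ i, ∏ j ∈ Finset.Ioi i, w i j) ^ 2 = ∏ i, ∏ j, if j = i then 1 else w j i := by
    intro w hw
    rw [sq, ← Finset.prod_mul_distrib]
    simp_rw [← Finset.prod_mul_distrib]
    rw [Finset.prod_congr rfl fun i _ => Finset.prod_congr rfl fun j _ => by
      rw [show w i j * w i j = w j i * w i j by rw [hw j i]],
      Finset.prod_prod_Ioi_mul_eq_prod_prod_off_diag]
    refine Finset.prod_congr rfl fun i _ => ?_
    rw [← Finset.prod_subset (Finset.subset_univ ({i}ᶜ : Finset (Fin N)))]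
    · exact Finset.prod_congr rfl fun j hj => by rw [if_neg (by simpa using hj)]
    · intro j _ hj
      rw [if_pos (by simpa using hj)]
  have key : (∏ i, ∏ j ∈ Finset.Ioi i, w (σ i) (σ j)) ^ 2 =
      (∏ i, ∏ j ∈ Finset.Ioi i, w i j) ^ 2 := by
    rw [hsq (fun i j => w (σ i) (σ j)) fun i j => hw _ _, hsq w hw,
      ← Equiv.prod_comp σ fun i => ∏ j, if j = i then 1 else w j i]
    refine Finset.prod_congr rfl fun i _ => ?_
    rw [← Equiv.prod_comp σ fun j => if j = σ i then 1 else w j (σ i)]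
    simp
  exact (pow_left_inj₀ (Finset.prod_nonneg fun i _ => Finset.prod_nonneg fun j _ => h0 _ _)
    (Finset.prod_nonneg fun i _ => Finset.prod_nonneg fun j _ => h0 _ _) two_ne_zero).1 key

theorem bTypeFunction_rename (f : MvPolynomial (Fin N) ℂ) (r s : ℝ) (σ : Equiv.Perm (Fin N))
    (x : Fin N → ℝ) :
    bTypeFunction (MvPolynomial.rename σ.symm f) r s (x ∘ σ) = bTypeFunction f r s x := by
  unfold bTypeFunction
  congr 1
  · rw [MvPolynomial.eval_rename]
    congr 2
    funext i
    simp
  · congr 2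
    · exact prod_Ioi_comp_perm σ (w := fun i j => |x i ^ 2 - x j ^ 2| ^ (1 / r))
        (fun i j => by positivity) fun i j => by rw [abs_sub_comm]
    · exact Equiv.prod_comp σ fun i => |x i| ^ (1 / 2 - s / r)

theorem norm_bTypeFunction_sq (f : MvPolynomial (Fin N) ℂ) (r s : ℝ) (x : Fin N → ℝ) :
    ‖bTypeFunction f r s x‖ ^ 2 = ‖MvPolynomial.eval (fun i => (x i : ℂ)) f‖ ^ 2 *
      ((∏ i, ∏ j ∈ Finset.Ioi i, |(|x i| ^ 2 - |x j| ^ 2)| ^ (-2 / r)) *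
        ∏ i, |x i| ^ (-1 + 2 * s / r)) := by
  have hpow : ∀ y p : ℝ, 0 ≤ y → ((y ^ p)⁻¹) ^ 2 = y ^ (-2 * p) := by
    intro y p hy
    rw [← Real.rpow_neg hy, ← Real.rpow_natCast, ← Real.rpow_mul hy]
    congr 1
    push_cast
    ring
  unfold bTypeFunction
  rw [norm_div, Complex.norm_real, Real.norm_of_nonneg (by positivity), div_pow, div_eq_mul_inv,
    mul_pow, mul_inv]
  congr 2
  · rw [← inv_pow, ← Finset.prod_inv_distrib, ← Finset.prod_pow]
    refine Finset.prod_congr rfl fun i _ => ?_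
    rw [← Finset.prod_inv_distrib, ← Finset.prod_pow]
    refine Finset.prod_congr rfl fun j _ => ?_
    rw [hpow _ _ (abs_nonneg _), sq_abs, sq_abs]
    congr 1
    ring
  · rw [← inv_pow, ← Finset.prod_inv_distrib, ← Finset.prod_pow]
    refine Finset.prod_congr rfl fun i _ => ?_
    rw [hpow _ _ (abs_nonneg _)]
    congr 1
    ring

/-- On each sorted part `|x 0| < |x 1| < ⋯` of a box, with gaps `d`, `|f|²` is bounded by a sum of
products of powers of the `|x i|` and of the gaps, each of which makes the density integrable. -/
def GapDominated (f : MvPolynomial (Fin N) ℂ) (r s : ℝ) : Prop :=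
  ∃ (ι : Type) (_ : Fintype ι) (b γ : ι → Fin N → ℝ),
    (∀ κ, ∀ T : Finset (Fin N), T.Nonempty →
      0 < scaleExponent (-2 / r) (fun i => -1 + 2 * s / r + b κ i) (γ κ) T) ∧
    ∀ R : ℝ, 0 < R → ∃ C : ℝ, 0 < C ∧ ∀ x d : Fin N → ℝ, (∀ l, 0 < d l) →
      (∀ i, |x i| = ∑ l ∈ Finset.Iic i, d l) → (∀ i, |x i| ≤ R) →
      ‖MvPolynomial.eval (fun i => (x i : ℂ)) f‖ ^ 2 ≤
        C * ∑ κ, (∏ i, |x i| ^ b κ i) * ∏ l, d l ^ γ κ l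

theorem chainWeight_eq (e R : ℝ) (x : Fin N → ℝ) (hx : ∀ i, |x i| ≤ R) :
    chainWeight e R 0 x = ∏ l, ENNReal.ofReal |(|x l| -
      (Fin.cons 0 fun i => |x i| : Fin (N + 1) → ℝ) l.castSucc)| ^ e := by
  refine Finset.prod_congr rfl fun l _ => ?_
  rw [chainKernel, Set.indicator_of_mem (Set.mem_Icc.2 (abs_le.1 (hx l)))]

theorem exists_bound_of_gapDominated {f : MvPolynomial (Fin N) ℂ} {r s : ℝ}
    (hf : GapDominated f r s) {R : ℝ} (hR : 0 < R) :
    ∃ B : (Fin N → ℝ) → ℝ≥0∞, Measurable B ∧ ∫⁻ x, B x < ∞ ∧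
      ∀ x, (∀ i, |x i| ≤ R) → Monotone (fun i => |x i|) →
        ‖bTypeFunction f r s x‖ₑ ^ 2 ≤ B x := by
  obtain ⟨ι, _, b, γ, hpos, hdom⟩ := hf
  choose ε hε0 hε1 hε using fun κ => exists_density_le _ _ _ (hpos κ)
  choose c hc0 hc using fun κ => hε κ R hR
  obtain ⟨C, hC0, hC⟩ := hdom R hR
  refine ⟨fun x => chainWeight (-1 / 2) R 0 x +
    ∑ κ, ENNReal.ofReal (C * c κ) * chainWeight (ε κ - 1) R 0 x, ?_, ?_, ?_⟩
  · exact (measurable_chainWeight _ _ _).add (Finset.measurable_sum _ fun κ _ =>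
      (measurable_chainWeight _ _ _).const_mul _)
  · rw [lintegral_add_left (measurable_chainWeight _ _ _), lintegral_finsetSum _ fun κ _ =>
      (measurable_chainWeight _ _ _).const_mul _]
    refine ENNReal.add_lt_top.2 ⟨lintegral_chainWeight_lt_top (by norm_num) (by norm_num) _ _ _,
      ENNReal.sum_lt_top.2 fun κ _ => ?_⟩
    rw [lintegral_const_mul _ (measurable_chainWeight _ _ _)]
    exact ENNReal.mul_lt_top ENNReal.ofReal_lt_top (lintegral_chainWeight_lt_top
      (by linarith [hε0 κ]) (by linarith [hε1 κ]) _ _ _)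
  · intro x hxR hmono
    set u : Fin (N + 1) → ℝ := Fin.cons 0 fun i => |x i| with hu
    set d : Fin N → ℝ := fun l => u l.succ - u l.castSucc with hd
    have hdl : ∀ l, |x l| - u l.castSucc = d l := fun l => by simp [hd, hu]
    have hu0 : ∀ m, 0 ≤ u m := fun m => by
      cases m using Fin.cases with
      | zero => simp [hu]
      | succ m => simp [hu]
    have hd0 : ∀ l, 0 ≤ d l := fun l => by
      rw [← hdl, sub_nonneg]
      rcases Fin.eq_zero_or_eq_succ l.castSucc with h | ⟨m, h⟩
      · rw [h]; simp [hu]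
      · rw [h]
        simp only [hu, Fin.cons_succ]
        refine hmono ?_
        rw [Fin.le_iff_val_le_val]
        have := congrArg Fin.val h
        simp at this
        omega
    have hdR : ∀ l, d l ≤ R := fun l => by
      rw [← hdl]
      linarith [hxR l, hu0 l.castSucc]
    have hsum : ∀ i, |x i| = ∑ l ∈ Finset.Iic i, d l := fun i => by
      rw [hd, Fin.sum_Iic_sub]
      simp [hu]
    by_cases hpos : ∀ l, 0 < d l
    · refine le_trans ?_ le_add_self
      have hw : ∀ e, chainWeight e R 0 x = ENNReal.ofReal (∏ l, d l ^ e) := by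
        intro e
        rw [chainWeight_eq _ _ _ hxR, ENNReal.ofReal_prod_of_nonneg fun l _ =>
          Real.rpow_nonneg (hd0 l) _]
        refine Finset.prod_congr rfl fun l _ => ?_
        rw [hdl, abs_of_nonneg (hd0 l), ENNReal.ofReal_rpow_of_pos (hpos l)]
      simp only [hw]
      rw [← ofReal_norm, ← ENNReal.ofReal_pow (norm_nonneg _)]
      have hxpos : ∀ i, 0 < |x i| := fun i => by
        rw [hsum]
        exact Finset.sum_pos (fun l _ => hpos l) ⟨i, by simp⟩
      have hprod0 : ∀ κ, 0 ≤ C * c κ := fun κ => (mul_pos hC0 (hc0 κ)).le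
      have hprod1 : ∀ κ, 0 ≤ ∏ l, d l ^ (ε κ - 1) := fun κ =>
        Finset.prod_nonneg fun l _ => Real.rpow_nonneg (hd0 l) _
      simp only [← ENNReal.ofReal_mul (hprod0 _)]
      rw [← ENNReal.ofReal_sum_of_nonneg fun κ _ => mul_nonneg (hprod0 κ) (hprod1 κ)]
      refine ENNReal.ofReal_le_ofReal ?_
      rw [norm_bTypeFunction_sq]
      refine (mul_le_mul_of_nonneg_right (hC x d hpos hsum hxR) (by positivity)).trans ?_
      rw [mul_assoc, Finset.sum_mul, Finset.mul_sum]
      refine Finset.sum_le_sum fun κ _ => ?_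
      rw [mul_assoc C]
      refine mul_le_mul_of_nonneg_left ?_ hC0.le
      refine le_trans (le_of_eq ?_) (hc κ d (fun i => |x i|) (fun l => ⟨hpos l, hdR l⟩) hsum)
      have : ∏ i, |x i| ^ (-1 + 2 * s / r + b κ i) =
          (∏ i, |x i| ^ (-1 + 2 * s / r)) * ∏ i, |x i| ^ b κ i := by
        rw [← Finset.prod_mul_distrib]
        exact Finset.prod_congr rfl fun i _ => Real.rpow_add (hxpos i) _ _
      rw [this]
      ring
    · push Not at hpos
      obtain ⟨l, hl⟩ := hpos
      have htop : chainWeight (-1 / 2) R 0 x = ∞ := by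
        have hzero : ENNReal.ofReal |(|x l| - u l.castSucc)| ^ (-1 / 2 : ℝ) = ∞ := by
          rw [hdl, le_antisymm hl (hd0 l), abs_zero, ENNReal.ofReal_zero,
            ENNReal.zero_rpow_of_neg (by norm_num)]
        rw [chainWeight_eq _ _ _ hxR, ← Finset.mul_prod_erase _ _ (Finset.mem_univ l), hzero,
          ENNReal.top_mul]
        · refine Finset.prod_ne_zero_iff.2 fun m _ => ?_
          rw [Ne, ENNReal.rpow_eq_zero_iff]
          rintro (⟨-, h⟩ | ⟨h, -⟩)
          · norm_num at h
          · exact ENNReal.ofReal_ne_top h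
      simp only [htop, top_add, le_top]

theorem measurable_bTypeFunction (f : MvPolynomial (Fin N) ℂ) (r s : ℝ) :
    Measurable (bTypeFunction f r s) := by
  unfold bTypeFunction
  refine Measurable.div ?_ ?_
  · have : Continuous fun x : Fin N → ℝ => MvPolynomial.eval (fun i => (x i : ℂ)) f :=
      (MvPolynomial.continuous_eval f).comp (by fun_prop)
    exact this.measurable
  · fun_prop

theorem locallyL2Integrable_of_gapDominated {f : MvPolynomial (Fin N) ℂ} {r s : ℝ}
    (hf : ∀ σ : Equiv.Perm (Fin N), GapDominated (MvPolynomial.rename σ f) r s) :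
    LocallyL2Integrable (bTypeFunction f r s) := by
  intro P
  set R : ℝ := ‖P‖ + 1 with hRdef
  have hR : 0 < R := by positivity
  refine ⟨Metric.closedBall 0 R, Metric.closedBall_mem_nhds_of_mem (by simp [hRdef]), ?_⟩
  refine ⟨(measurable_bTypeFunction f r s).aestronglyMeasurable, ?_⟩
  rw [eLpNorm_lt_top_iff_lintegral_rpow_enorm_lt_top two_ne_zero ENNReal.ofNat_ne_top]
  choose B hBm hBfin hB using fun σ : Equiv.Perm (Fin N) =>
    exists_bound_of_gapDominated (hf σ.symm) hR
  have hmp : ∀ σ : Equiv.Perm (Fin N), MeasurePreserving (fun x : Fin N → ℝ => x ∘ σ) := by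
    intro σ
    convert! volume_measurePreserving_piCongrLeft (fun _ : Fin N => ℝ) σ.symm using 1
    ext x i
    obtain ⟨i, rfl⟩ := σ.symm.surjective i
    rw [MeasurableEquiv.piCongrLeft_apply_apply]
    simp
  calc ∫⁻ x in Metric.closedBall 0 R, ‖bTypeFunction f r s x‖ₑ ^ (2 : ℝ≥0∞).toReal
      ≤ ∫⁻ x in Metric.closedBall 0 R, ∑ σ, B σ (x ∘ σ) := by
        refine setLIntegral_mono' Metric.isClosed_closedBall.measurableSet fun x hx => ?_
        have hxR : ∀ i, |x i| ≤ R := fun i =>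
          (norm_le_pi_norm x i).trans (by simpa using hx)
        set σ := Tuple.sort fun i => |x i|
        refine le_trans ?_ (Finset.single_le_sum (f := fun σ : Equiv.Perm (Fin N) => B σ (x ∘ σ))
          (fun _ _ => zero_le) (Finset.mem_univ σ))
        have := hB σ (x ∘ σ) (fun i => hxR _) (Tuple.monotone_sort fun i => |x i|)
        rw [bTypeFunction_rename] at this
        simpa using this
    _ ≤ ∫⁻ x, ∑ σ, B σ (x ∘ σ) := setLIntegral_le_lintegral _ _
    _ = ∑ σ, ∫⁻ x, B σ x := by
        rw [lintegral_finsetSum (f := fun (σ : Equiv.Perm (Fin N)) x => B σ (x ∘ σ)) _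
          fun σ _ => (hBm σ).comp (hmp σ).measurable]
        exact Finset.sum_congr rfl fun σ _ => (hmp σ).lintegral_comp (hBm σ)
    _ < ∞ := ENNReal.sum_lt_top.2 fun σ _ => hBfin σ

end LocalIntegrability

section Counting

variable {N : ℕ}

/-- The number of indices in block `q` when the gaps in `T` are collapsed. -/
def blockCard (T : Finset (Fin N)) (q : ℕ) : ℕ := (Finset.univ.filter fun i => gapBlock T i = q).card

theorem gapBlock_mem_range (T : Finset (Fin N)) (i : Fin N) :
    gapBlock T i ∈ Finset.range (Tᶜ.card + 1) := by
  rw [Finset.mem_range, Nat.lt_succ_iff]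
  refine Finset.card_le_card fun l hl => ?_
  simpa using (Finset.mem_filter.1 hl).2

theorem image_gapBlock_compl (T : Finset (Fin N)) :
    Tᶜ.image (gapBlock T) = Finset.Icc 1 Tᶜ.card := by
  refine Finset.eq_of_subset_of_card_le (fun q hq => ?_) ?_
  · obtain ⟨i, hi, rfl⟩ := Finset.mem_image.1 hq
    have h1 := Finset.mem_range.1 (gapBlock_mem_range T i)
    have h2 : gapBlock T i ≠ 0 := fun h => by
      have := gapBlock_eq_zero_iff.1 h (Finset.mem_Iic.2 le_rfl)
      exact Finset.mem_compl.1 hi this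
    rw [Finset.mem_Icc]
    omega
  · rw [Finset.card_image_of_injOn, Nat.card_Icc]
    · omega
    · intro i hi j hj hij
      simp only [Finset.coe_compl, Set.mem_compl_iff, Finset.mem_coe] at hi hj
      rcases lt_trichotomy i j with h | h | h
      · exact absurd ((gapBlock_eq_iff h.le).1 hij (Finset.mem_Ioc.2 ⟨h, le_rfl⟩)) hj
      · exact h
      · exact absurd ((gapBlock_eq_iff h.le).1 hij.symm (Finset.mem_Ioc.2 ⟨h, le_rfl⟩)) hi

theorem one_le_blockCard {T : Finset (Fin N)} {q : ℕ} (hq : q ∈ Finset.Icc 1 Tᶜ.card) :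
    1 ≤ blockCard T q := by
  rw [← image_gapBlock_compl] at hq
  obtain ⟨i, -, hi⟩ := Finset.mem_image.1 hq
  exact Finset.card_pos.2 ⟨i, by simp [hi]⟩

theorem blockCard_le (T : Finset (Fin N)) (q : ℕ) : blockCard T q ≤ N :=
  (Finset.card_le_univ _).trans_eq (Fintype.card_fin N)

theorem sum_range_succ_eq_add_Icc (n : ℕ) (φ : ℕ → ℝ) :
    ∑ q ∈ Finset.range (n + 1), φ q = φ 0 + ∑ q ∈ Finset.Icc 1 n, φ q := by
  have h : Finset.range (n + 1) = insert 0 (Finset.Icc 1 n) := by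
    ext q; simp; omega
  rw [h, Finset.sum_insert (by simp)]

theorem sum_comp_gapBlock (T : Finset (Fin N)) (φ : ℕ → ℝ) :
    ∑ i, φ (gapBlock T i) =
      blockCard T 0 * φ 0 + ∑ q ∈ Finset.Icc 1 Tᶜ.card, blockCard T q * φ q := by
  rw [← sum_range_succ_eq_add_Icc Tᶜ.card fun q => blockCard T q * φ q,
    ← Finset.sum_fiberwise_of_maps_to fun i _ => gapBlock_mem_range T i]
  refine Finset.sum_congr rfl fun q _ => ?_
  rw [Finset.sum_congr rfl fun i hi => by rw [(Finset.mem_filter.1 hi).2], Finset.sum_const,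
    nsmul_eq_mul, blockCard]

theorem card_eq_add_sum_blockCard (T : Finset (Fin N)) :
    (T.card : ℝ) = blockCard T 0 + ∑ q ∈ Finset.Icc 1 Tᶜ.card, ((blockCard T q : ℝ) - 1) := by
  have h1 := sum_comp_gapBlock T fun _ => 1
  have h2 := Finset.card_add_card_compl T
  have h3 : (T.card : ℝ) + Tᶜ.card = N := by
    rw [← Nat.cast_add, h2, Fintype.card_fin]
  simp only [Finset.sum_const, Finset.card_univ, Fintype.card_fin, nsmul_eq_mul, mul_one] at h1
  rw [Finset.sum_sub_distrib]
  simp only [Finset.sum_const, Nat.card_Icc, nsmul_eq_mul, mul_one, Nat.add_sub_cancel]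
  linarith

theorem two_mul_sum_orderedPairs (g : Fin N → Fin N → ℝ) (hg : ∀ i j, g i j = g j i) :
    2 * ∑ p ∈ orderedPairs N, g p.1 p.2 = ∑ i, ((∑ j, g j i) - g i i) := by
  rw [← sum_sum_Ioi_eq g, Finset.mul_sum]
  simp_rw [Finset.mul_sum]
  rw [Finset.sum_congr rfl fun i _ => Finset.sum_congr rfl fun j _ => by
    rw [show 2 * g i j = g j i + g i j by rw [hg j i]; ring],
    Finset.sum_sum_Ioi_add_eq_sum_sum_off_diag]
  refine Finset.sum_congr rfl fun i _ => ?_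
  rw [← Finset.sum_add_sum_compl {i} fun j => g j i, Finset.sum_singleton]
  ring

theorem two_mul_sum_orderedPairs_same (T : Finset (Fin N)) (a : ℝ) :
    2 * ∑ p ∈ orderedPairs N, (if gapBlock T p.1 = gapBlock T p.2 then a else 0) =
      a * (blockCard T 0 * (blockCard T 0 - 1) +
        ∑ q ∈ Finset.Icc 1 Tᶜ.card, (blockCard T q : ℝ) * (blockCard T q - 1)) := by
  rw [two_mul_sum_orderedPairs (fun i j => if gapBlock T i = gapBlock T j then a else 0)
    fun i j => by simp only [eq_comm], mul_add, Finset.mul_sum]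
  have : ∀ i, (∑ j, if gapBlock T j = gapBlock T i then a else 0) -
      (if gapBlock T i = gapBlock T i then a else 0) = a * (blockCard T (gapBlock T i) - 1) := by
    intro i
    rw [← Finset.sum_filter, Finset.sum_const, if_pos rfl, nsmul_eq_mul, blockCard]
    ring
  rw [Finset.sum_congr rfl fun i _ => this i, sum_comp_gapBlock T fun q => a * ((blockCard T q : ℝ) - 1)]
  congr 1
  · ring
  · exact Finset.sum_congr rfl fun q _ => by ring

theorem two_mul_sum_orderedPairs_zero (T : Finset (Fin N)) (a : ℝ) :
    2 * ∑ p ∈ orderedPairs N, (if gapBlock T p.2 = 0 then a else 0) =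
      a * (blockCard T 0 * (blockCard T 0 - 1)) := by
  have h1 : ∀ p ∈ orderedPairs N, (if gapBlock T p.2 = 0 then a else 0) =
      if gapBlock T p.1 = 0 ∧ gapBlock T p.2 = 0 then a else 0 := by
    intro p hp
    refine if_congr ⟨fun h => ⟨?_, h⟩, fun h => h.2⟩ rfl rfl
    rw [gapBlock_eq_zero_iff] at h ⊢
    exact (Finset.Iic_subset_Iic.2 (Finset.mem_filter.1 hp).2.le).trans h
  rw [Finset.sum_congr rfl h1, two_mul_sum_orderedPairs
    (fun i j => if gapBlock T i = 0 ∧ gapBlock T j = 0 then a else 0)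
    fun i j => by simp only [and_comm]]
  have h2 : ∀ i, (∑ j, if gapBlock T j = 0 ∧ gapBlock T i = 0 then a else 0) -
      (if gapBlock T i = 0 ∧ gapBlock T i = 0 then a else 0) =
      if gapBlock T i = 0 then a * (blockCard T 0 - 1) else 0 := by
    intro i
    by_cases hi : gapBlock T i = 0
    · simp only [hi, and_true, if_true]
      rw [← Finset.sum_filter, Finset.sum_const, nsmul_eq_mul, blockCard]
      ring
    · simp [hi]
  simp only [h2]
  rw [← Finset.sum_filter, Finset.sum_const, nsmul_eq_mul, ← blockCard]
  ring

theorem scaleExponent_eq (r s : ℝ) (b γ : Fin N → ℝ) (T : Finset (Fin N)) :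
    scaleExponent (-2 / r) (fun i => -1 + 2 * s / r + b i) γ T =
      2 * blockCard T 0 * (s - blockCard T 0 + 1) / r +
      ∑ q ∈ Finset.Icc 1 Tᶜ.card, ((blockCard T q : ℝ) - 1) * (1 - blockCard T q / r) +
      ((∑ i with gapBlock T i = 0, b i) + ∑ l ∈ T, γ l) := by
  have h1 := two_mul_sum_orderedPairs_same T (-2 / r)
  have h2 := two_mul_sum_orderedPairs_zero T (-2 / r)
  have h3 := card_eq_add_sum_blockCard T
  have h4 : (∑ i, if gapBlock T i = 0 then -1 + 2 * s / r + b i else 0) =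
      blockCard T 0 * (-1 + 2 * s / r) + ∑ i with gapBlock T i = 0, b i := by
    rw [← Finset.sum_filter, Finset.sum_add_distrib, Finset.sum_const, nsmul_eq_mul, blockCard]
  have h5 : ∑ q ∈ Finset.Icc 1 Tᶜ.card, ((blockCard T q : ℝ) - 1) * (1 - blockCard T q / r) =
      ∑ q ∈ Finset.Icc 1 Tᶜ.card, ((blockCard T q : ℝ) - 1) + -2 / r / 2 *
        ∑ q ∈ Finset.Icc 1 Tᶜ.card, (blockCard T q : ℝ) * (blockCard T q - 1) := by
    rw [Finset.mul_sum, ← Finset.sum_add_distrib]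
    exact Finset.sum_congr rfl fun q _ => by ring
  rw [scaleExponent, h4, h5]
  linear_combination h1 / 2 + h2 / 2 + h3

theorem scaleExponent_pos {r s : ℝ} {b γ : Fin N → ℝ} {T : Finset (Fin N)} (hT : T.Nonempty)
    (X : ℕ → ℝ) (hX : X 0 + ∑ q ∈ Finset.Icc 1 Tᶜ.card, X q ≤
      (∑ i with gapBlock T i = 0, b i) + ∑ l ∈ T, γ l)
    (hX0 : ∀ q, 0 ≤ X q)
    (hzero : 1 ≤ blockCard T 0 →
      0 < 2 * blockCard T 0 * (s - blockCard T 0 + 1) / r + X 0)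
    (hblock : ∀ q ∈ Finset.Icc 1 Tᶜ.card, 2 ≤ blockCard T q →
      0 < ((blockCard T q : ℝ) - 1) * (1 - blockCard T q / r) + X q) :
    0 < scaleExponent (-2 / r) (fun i => -1 + 2 * s / r + b i) γ T := by
  rw [scaleExponent_eq]
  have hnonneg : ∀ q ∈ Finset.Icc 1 Tᶜ.card,
      0 ≤ ((blockCard T q : ℝ) - 1) * (1 - blockCard T q / r) + X q := by
    intro q hq
    rcases (one_le_blockCard hq).eq_or_lt with h | h
    · rw [← h]; simpa using hX0 q
    · exact (hblock q hq h).le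
  have hsum : 0 ≤ ∑ q ∈ Finset.Icc 1 Tᶜ.card,
      (((blockCard T q : ℝ) - 1) * (1 - blockCard T q / r) + X q) := Finset.sum_nonneg hnonneg
  suffices h : 0 < 2 * blockCard T 0 * (s - blockCard T 0 + 1) / r + X 0 +
      ∑ q ∈ Finset.Icc 1 Tᶜ.card,
        (((blockCard T q : ℝ) - 1) * (1 - blockCard T q / r) + X q) by
    rw [Finset.sum_add_distrib] at h
    linarith
  rcases Nat.eq_zero_or_pos (blockCard T 0) with h0 | h0
  · have hcard := card_eq_add_sum_blockCard T
    rw [h0, Nat.cast_zero, zero_add] at hcard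
    obtain ⟨q, hq, hq2⟩ : ∃ q ∈ Finset.Icc 1 Tᶜ.card, 2 ≤ blockCard T q := by
      by_contra! hcon
      rw [Finset.sum_eq_zero fun q hq => ?_] at hcard
      · exact hT.card_pos.ne' (by exact_mod_cast hcard)
      · have h1 := one_le_blockCard hq
        have h2 := hcon q hq
        rw [show blockCard T q = 1 by omega]
        simp
    have h3 := Finset.single_le_sum hnonneg hq
    have h4 := hblock q hq hq2
    have h5 := hX0 0
    rw [h0]
    simp only [Nat.cast_zero, mul_zero, zero_mul, zero_div, zero_add]
    linarith
  · exact add_pos_of_pos_of_nonneg (hzero h0) hsum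

end Counting

section MonomialDomination

open MvPolynomial

variable {N : ℕ}

theorem norm_eval_sq_le (P : MvPolynomial (Fin N) ℂ) (z : Fin N → ℂ) :
    ‖eval z P‖ ^ 2 ≤ P.support.card * ∑ a ∈ P.support, ‖coeff a P‖ ^ 2 * ∏ i, ‖z i‖ ^ (2 * a i) := by
  rw [eval_eq']
  calc ‖∑ a ∈ P.support, coeff a P * ∏ i, z i ^ a i‖ ^ 2
      ≤ (∑ a ∈ P.support, ‖coeff a P * ∏ i, z i ^ a i‖) ^ 2 := by
        gcongr
        exact norm_sum_le _ _
    _ ≤ P.support.card * ∑ a ∈ P.support, ‖coeff a P * ∏ i, z i ^ a i‖ ^ 2 :=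
        sq_sum_le_card_mul_sum_sq
    _ = _ := by
        congr 1
        refine Finset.sum_congr rfl fun a _ => ?_
        rw [norm_mul, mul_pow, norm_prod, ← Finset.prod_pow]
        congr 1
        refine Finset.prod_congr rfl fun i _ => ?_
        rw [norm_pow, ← pow_mul, mul_comm]

theorem gapDominated_of_support {f : MvPolynomial (Fin N) ℂ} {r s : ℝ}
    (h : ∀ a ∈ f.support, ∀ T : Finset (Fin N), T.Nonempty →
      0 < scaleExponent (-2 / r) (fun i => -1 + 2 * s / r + if a i = 0 then 0 else 2) 0 T) :
    GapDominated f r s := by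
  refine ⟨{a // a ∈ f.support}, inferInstance, fun a i => if a.1 i = 0 then 0 else 2, fun _ => 0,
    fun a => h a.1 a.2, fun R hR => ?_⟩
  set M : ℝ := max 1 R with hM
  have hM1 : 1 ≤ M := le_max_left _ _
  refine ⟨1 + f.support.card * ∑ a ∈ f.support, ‖coeff a f‖ ^ 2 * ∏ i, M ^ (2 * a i),
    by positivity, fun x d hd hx hxR => (norm_eval_sq_le f _).trans ?_⟩
  have hterm : ∀ a ∈ f.support, ‖coeff a f‖ ^ 2 * ∏ i, ‖(x i : ℂ)‖ ^ (2 * a i) ≤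
      (∑ a ∈ f.support, ‖coeff a f‖ ^ 2 * ∏ i, M ^ (2 * a i)) *
        ∏ i, |x i| ^ (if a i = 0 then 0 else 2 : ℝ) := by
    intro a ha
    have h1 : ∀ i, ‖(x i : ℂ)‖ ^ (2 * a i) ≤
        M ^ (2 * a i) * |x i| ^ (if a i = 0 then 0 else 2 : ℝ) := by
      intro i
      rw [Complex.norm_real, Real.norm_eq_abs]
      split_ifs with hi
      · simp [hi]
      · obtain ⟨n, hn⟩ := Nat.exists_eq_succ_of_ne_zero hi
        have h2 : |x i| ^ (2 : ℝ) = |x i| ^ 2 := by exact_mod_cast Real.rpow_natCast |x i| 2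
        rw [hn, h2, Nat.succ_eq_add_one, mul_add, mul_one, pow_add]
        have h3 : |x i| ^ (2 * n) ≤ M ^ (2 * n + 2) := by
          calc |x i| ^ (2 * n) ≤ M ^ (2 * n) :=
                pow_le_pow_left₀ (abs_nonneg _) ((hxR i).trans (le_max_right _ _)) _
            _ ≤ M ^ (2 * n + 2) := pow_le_pow_right₀ hM1 (by omega)
        gcongr
    calc ‖coeff a f‖ ^ 2 * ∏ i, ‖(x i : ℂ)‖ ^ (2 * a i)
        ≤ ‖coeff a f‖ ^ 2 * ∏ i, (M ^ (2 * a i) * |x i| ^ (if a i = 0 then 0 else 2 : ℝ)) := by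
          gcongr with i
          exact h1 i
      _ = (‖coeff a f‖ ^ 2 * ∏ i, M ^ (2 * a i)) *
            ∏ i, |x i| ^ (if a i = 0 then 0 else 2 : ℝ) := by
          rw [Finset.prod_mul_distrib, mul_assoc]
      _ ≤ _ := by
          refine mul_le_mul_of_nonneg_right ?_ (by positivity)
          exact Finset.single_le_sum
            (f := fun a : Fin N →₀ ℕ => ‖coeff a f‖ ^ 2 * ∏ i, M ^ (2 * a i))
            (fun a _ => by positivity) ha
  simp only [Pi.zero_apply, Real.rpow_zero, Finset.prod_const_one, mul_one]
  rw [Finset.univ_eq_attach, Finset.sum_attach f.support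
    fun a => ∏ i, |x i| ^ (if a i = 0 then 0 else 2 : ℝ)]
  refine (mul_le_mul_of_nonneg_left (Finset.sum_le_sum hterm) (Nat.cast_nonneg _)).trans ?_
  rw [← Finset.mul_sum, ← mul_assoc]
  refine mul_le_mul_of_nonneg_right ?_ (Finset.sum_nonneg fun a _ => by positivity)
  linarith

theorem gapDominated_of_gapPoly {f : MvPolynomial (Fin N) ℂ} {r s : ℝ}
    (h : ∀ η : Fin N → ℤˣ, ∀ a ∈ (gapPoly (aeval (fun i => C ((η i : ℤ) : ℂ) * X i) f)).support,
      ∀ T : Finset (Fin N), T.Nonempty →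
      0 < scaleExponent (-2 / r) (fun _ => -1 + 2 * s / r + 0) (fun l => ((2 * a l : ℕ) : ℝ)) T) :
    GapDominated f r s := by
  set P : (Fin N → ℤˣ) → MvPolynomial (Fin N) ℂ :=
    fun η => gapPoly (aeval (fun i => C ((η i : ℤ) : ℂ) * X i) f) with hP
  refine ⟨Σ η : Fin N → ℤˣ, {a // a ∈ (P η).support}, inferInstance, fun _ _ => 0,
    fun κ l => ((2 * κ.2.1 l : ℕ) : ℝ), fun κ => h κ.1 κ.2.1 κ.2.2, fun R hR => ?_⟩
  set c : (Fin N → ℤˣ) → ℝ := fun η => (P η).support.card *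
    ∑ a ∈ (P η).support, ‖coeff a (P η)‖ ^ 2 with hc
  have hc0 : ∀ η, 0 ≤ c η := fun η => by positivity
  refine ⟨1 + ∑ η, c η, add_pos_of_pos_of_nonneg one_pos (Finset.sum_nonneg fun η _ => hc0 η),
    fun x d hd hx hxR => ?_⟩
  set η : Fin N → ℤˣ := fun i => if 0 ≤ x i then 1 else -1 with hη
  have hxη : ∀ i, (x i : ℂ) = ((η i : ℤ) : ℂ) * (|x i| : ℝ) := by
    intro i
    simp only [hη]
    split_ifs with hi
    · simp [abs_of_nonneg hi]
    · simp [abs_of_neg (not_le.1 hi)]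
  have heval : eval (fun i => (x i : ℂ)) f = eval (fun l => (d l : ℂ)) (P η) := by
    rw [hP, eval_gapPoly, ← aeval_eq_eval, ← aeval_eq_eval, ← AlgHom.comp_apply]
    congr 1
    refine algHom_ext fun i => ?_
    rw [AlgHom.comp_apply, aeval_X, aeval_X, hxη i, hx i]
    simp
  rw [heval]
  refine (norm_eval_sq_le _ _).trans ?_
  simp only [Real.rpow_zero, Finset.prod_const_one, one_mul, Real.rpow_natCast]
  rw [Fintype.sum_sigma]
  have hpos : ∀ η (a : Fin N →₀ ℕ), a ∈ (P η).support → 0 ≤ ∏ l, d l ^ (2 * a l) := fun η a _ =>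
    Finset.prod_nonneg fun l _ => (pow_pos (hd l) _).le
  calc ((P η).support.card : ℝ) * ∑ a ∈ (P η).support,
        ‖coeff a (P η)‖ ^ 2 * ∏ l, ‖(d l : ℂ)‖ ^ (2 * a l)
      = (P η).support.card * ∑ a ∈ (P η).support, ‖coeff a (P η)‖ ^ 2 * ∏ l, d l ^ (2 * a l) := by
        simp only [Complex.norm_real, Real.norm_of_nonneg (hd _).le]
    _ ≤ (P η).support.card * ∑ a ∈ (P η).support,
          (∑ a ∈ (P η).support, ‖coeff a (P η)‖ ^ 2) * ∏ l, d l ^ (2 * a l) := by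
        gcongr with a ha
        · exact hpos η a ha
        · exact Finset.single_le_sum (f := fun a => ‖coeff a (P η)‖ ^ 2)
            (fun a _ => by positivity) ha
    _ = c η * ∑ a ∈ (P η).support, ∏ l, d l ^ (2 * a l) := by
        rw [← Finset.mul_sum, ← mul_assoc]
    _ ≤ (1 + ∑ η, c η) * ∑ η, ∑ a ∈ (P η).support, ∏ l, d l ^ (2 * a l) := by
        have h1 : c η ≤ ∑ η, c η :=
          Finset.single_le_sum (f := c) (fun η _ => hc0 η) (Finset.mem_univ η)
        have h2 : ∑ a ∈ (P η).support, ∏ l, d l ^ (2 * a l) ≤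
            ∑ η, ∑ a ∈ (P η).support, ∏ l, d l ^ (2 * a l) :=
          Finset.single_le_sum (f := fun η => ∑ a ∈ (P η).support, ∏ l, d l ^ (2 * a l))
            (fun η _ => Finset.sum_nonneg fun a ha => hpos η a ha) (Finset.mem_univ η)
        have h3 : 0 ≤ ∑ a ∈ (P η).support, ∏ l, d l ^ (2 * a l) :=
          Finset.sum_nonneg fun a ha => hpos η a ha
        have := hc0 η
        exact mul_le_mul (by linarith) h2 h3 (by linarith)
    _ = _ := by
        congr 1
        refine Finset.sum_congr rfl fun η _ => ?_
        rw [Finset.univ_eq_attach, Finset.sum_attach (P η).support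
          fun a => ∏ l, d l ^ (2 * a l)]

end MonomialDomination

section Cases

open MvPolynomial

variable {N : ℕ}

theorem block_exponent_pos {m : ℕ} {r : ℝ} (hm : 2 ≤ m) (hr : r < 0 ∨ (m : ℝ) < r) :
    0 < ((m : ℝ) - 1) * (1 - m / r) := by
  have h2 : (2 : ℝ) ≤ m := by exact_mod_cast hm
  refine mul_pos (by linarith) ?_
  rcases hr with hr | hr
  · have : (m : ℝ) / r < 0 := div_neg_of_pos_of_neg (by linarith) hr
    linarith
  · rw [sub_pos, div_lt_one (by linarith)]
    exact hr

theorem locallyL2Integrable_of_exponent_pos {r s : ℝ} (hr : r < 0 ∨ (N : ℝ) < r)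
    (hs : ∀ m : ℕ, 1 ≤ m → m ≤ N → 0 < 2 * m * (s - m + 1) / r) (f : MvPolynomial (Fin N) ℂ) :
    LocallyL2Integrable (bTypeFunction f r s) := by
  refine locallyL2Integrable_of_gapDominated fun σ => gapDominated_of_support fun a _ T hT =>
    scaleExponent_pos hT (fun _ => 0) ?_ (fun _ => le_rfl) (fun h => ?_) fun q _ hq => ?_
  · simp only [Finset.sum_const_zero, Pi.zero_apply, add_zero]
    exact Finset.sum_nonneg fun i _ => by split_ifs <;> norm_num
  · rw [add_zero]
    exact hs _ h (blockCard_le T 0)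
  · rw [add_zero]
    have : (blockCard T q : ℝ) ≤ N := by exact_mod_cast blockCard_le T q
    exact block_exponent_pos hq (hr.imp id fun h => by linarith)

theorem card_zeros_le_of_mem_idealJ {k : ℕ} {f : MvPolynomial (Fin N) ℂ} (hf : f ∈ idealJ N k)
    {a : Fin N →₀ ℕ} (ha : a ∈ f.support) : (Finset.univ.filter fun i => a i = 0).card ≤ k := by
  by_contra! hlt
  obtain ⟨S, hS, hcard⟩ := Finset.exists_subset_card_eq (Nat.succ_le_of_lt hlt)
  refine sum_ne_of_mem_support f S 0 (fun d => ?_) ha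
    (Finset.sum_eq_zero fun l hl => (Finset.mem_filter.1 (hS hl)).2)
  rw [Polynomial.coeff_zero_eq_eval_zero]
  have h1 : ∀ p : MvPolynomial (Fin N) ℂ, (aeval (fun l => Polynomial.C (d l) *
      Polynomial.X ^ (if l ∈ S then 1 else 0)) p : Polynomial ℂ).eval 0 =
      aeval (fun l => if l ∈ S then 0 else d l) p := by
    intro p
    rw [← Polynomial.coe_aeval_eq_eval, ← AlgHom.comp_apply]
    congr 1
    refine algHom_ext fun l => ?_
    by_cases hl : l ∈ S <;> simp [hl]
  rw [h1]
  exact mem_vanishingIdeal_iff.1 hf _ ⟨S, hcard, fun i hi => by simp [hi]⟩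

theorem rename_mem_idealJ {k : ℕ} {f : MvPolynomial (Fin N) ℂ} (hf : f ∈ idealJ N k)
    (σ : Equiv.Perm (Fin N)) : rename σ f ∈ idealJ N k := by
  refine mem_vanishingIdeal_iff.2 ?_
  rintro x ⟨S, hS, hx⟩
  rw [aeval_rename]
  refine mem_vanishingIdeal_iff.1 hf _ ⟨S.map σ.symm.toEmbedding, by simpa using hS, fun i hi => ?_⟩
  simp only [Finset.mem_map_equiv, Equiv.symm_symm] at hi
  exact hx _ hi

theorem rename_mem_idealIpm {k : ℕ} {f : MvPolynomial (Fin N) ℂ} (hf : f ∈ idealIpm N k)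
    (σ : Equiv.Perm (Fin N)) : rename σ f ∈ idealIpm N k := by
  refine mem_vanishingIdeal_iff.2 ?_
  rintro x ⟨S, hS, ε, hε, hx⟩
  rw [aeval_rename]
  refine mem_vanishingIdeal_iff.1 hf _ ⟨S.map σ.symm.toEmbedding, by simpa using hS, ε ∘ σ,
    fun i => hε _, fun i hi j hj => ?_⟩
  simp only [Finset.mem_map_equiv, Equiv.symm_symm] at hi hj
  exact hx _ hi _ hj

theorem eval_signChange_eq_zero {k : ℕ} {f : MvPolynomial (Fin N) ℂ} (hf : f ∈ idealIpm N k)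
    (η : Fin N → ℤˣ) (x : Fin N → ℂ) (hx : x ∈ signedDiagonals N k) :
    eval x (aeval (fun i => C ((η i : ℤ) : ℂ) * X i) f) = 0 := by
  have h1 : eval x (aeval (fun i => C ((η i : ℤ) : ℂ) * X i) f) =
      aeval (fun i => ((η i : ℤ) : ℂ) * x i) f := by
    rw [← aeval_eq_eval, ← AlgHom.comp_apply]
    congr 1
    refine algHom_ext fun i => ?_
    simp
  rw [h1]
  obtain ⟨S, hS, ε, hε, hx⟩ := hx
  have hη : ∀ i, ((η i : ℤ) : ℂ) = 1 ∨ ((η i : ℤ) : ℂ) = -1 := fun i => by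
    rcases Int.units_eq_one_or (η i) with h | h <;> simp [h]
  refine mem_vanishingIdeal_iff.1 hf _ ⟨S, hS, fun i => ε i * ((η i : ℤ) : ℂ), fun i => ?_,
    fun i hi j hj => ?_⟩
  · rcases hε i with h | h <;> rcases hη i with h' | h' <;> simp [h, h']
  · have hsq : ∀ i, ((η i : ℤ) : ℂ) * ((η i : ℤ) : ℂ) = 1 := fun i => by
      rcases hη i with h | h <;> simp [h]
    have := hx i hi j hj
    linear_combination this + ε i * x i * hsq i - ε j * x j * hsq j

theorem locallyL2Integrable_of_mem_idealJ {k : ℕ} {r : ℝ} (hr : (N : ℝ) + 1 ≤ r)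
    {f : MvPolynomial (Fin N) ℂ} (hf : f ∈ idealJ N k) :
    LocallyL2Integrable (bTypeFunction f r k) := by
  refine locallyL2Integrable_of_gapDominated fun σ => gapDominated_of_support fun a ha T hT =>
    scaleExponent_pos hT (fun q => if q = 0 then
      ∑ i with gapBlock T i = 0, (if a i = 0 then 0 else 2 : ℝ) else 0) ?_ (fun q => ?_)
      (fun h => ?_) fun q _ hq => ?_
  · rw [Finset.sum_eq_zero (s := Finset.Icc 1 _) fun q hq => if_neg (by
      rw [Finset.mem_Icc] at hq; omega)]
    simp
  · split_ifs
    · exact Finset.sum_nonneg fun i _ => by split_ifs <;> norm_num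
    · exact le_rfl
  · simp only [if_true]
    set m := blockCard T 0 with hm
    have hmN : (m : ℝ) ≤ N := by exact_mod_cast blockCard_le T 0
    have hm1 : (1 : ℝ) ≤ m := by exact_mod_cast h
    have hr0 : 0 < r := by linarith
    have hX0 : 0 ≤ ∑ i with gapBlock T i = 0, (if a i = 0 then 0 else 2 : ℝ) :=
      Finset.sum_nonneg fun i _ => by split_ifs <;> norm_num
    have hX : 2 * ((m : ℝ) - k) ≤ ∑ i with gapBlock T i = 0, (if a i = 0 then 0 else 2 : ℝ) := by
      have h1 : ∑ i with gapBlock T i = 0, (if a i = 0 then 0 else 2 : ℝ) =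
          ∑ i with gapBlock T i = 0, (2 - if a i = 0 then 2 else 0 : ℝ) :=
        Finset.sum_congr rfl fun i _ => by split_ifs <;> norm_num
      have h2 : ∑ i with gapBlock T i = 0, (if a i = 0 then 2 else 0 : ℝ) ≤ k * 2 := by
        rw [← Finset.sum_filter, Finset.sum_const, nsmul_eq_mul]
        gcongr
        refine (Finset.card_le_card ?_).trans
          (card_zeros_le_of_mem_idealJ (rename_mem_idealJ hf σ) ha)
        exact Finset.filter_subset_filter _ (Finset.filter_subset _ _)
      rw [h1, Finset.sum_sub_distrib, Finset.sum_const, nsmul_eq_mul, ← blockCard, ← hm]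
      linarith
    rcases le_or_gt m k with hmk | hmk
    · have : (m : ℝ) ≤ k := by exact_mod_cast hmk
      have : 0 < 2 * (m : ℝ) * (k - m + 1) / r := by
        apply div_pos _ hr0
        apply mul_pos <;> linarith
      linarith
    · have hmk' : (k : ℝ) + 1 ≤ m := by exact_mod_cast hmk
      have : -(2 * ((m : ℝ) - k - 1)) ≤ 2 * (m : ℝ) * (k - m + 1) / r := by
        rw [le_div_iff₀ hr0]
        nlinarith [mul_nonneg (by linarith : (0 : ℝ) ≤ m - k - 1) (by linarith : (0 : ℝ) ≤ r - m)]
      linarith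
  · have h1 : (blockCard T q : ℝ) ≤ N := by exact_mod_cast blockCard_le T q
    have h2 := block_exponent_pos hq (Or.inr (by linarith : (blockCard T q : ℝ) < r))
    rename_i hq'
    rw [if_neg (by rw [Finset.mem_Icc] at hq'; omega), add_zero]
    exact h2

theorem zero_block_exponent_pos {k m : ℕ} {s : ℝ} (hk : 1 ≤ k) (hm : 1 ≤ m) (hs : (k : ℝ) ≤ s) :
    0 < 2 * m * (s - m + 1) / ((k + 1 : ℕ) : ℝ) + 4 * collapseOrder k m := by
  have hk' : (0 : ℝ) < k := by exact_mod_cast hk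
  have hm' : (0 : ℝ) < m := by exact_mod_cast hm
  have h1 : (m : ℝ) * (m - k) / (2 * k) ≤ collapseOrder k m := le_max_right _ _
  have h2 : 2 * (m : ℝ) * (k - m + 1) / ((k + 1 : ℕ) : ℝ) ≤
      2 * m * (s - m + 1) / ((k + 1 : ℕ) : ℝ) := by gcongr
  have h3 : 2 * (m : ℝ) * (k - m + 1) / ((k + 1 : ℕ) : ℝ) + 4 * ((m : ℝ) * (m - k) / (2 * k)) =
      2 * m ^ 2 / (k * (k + 1)) := by
    push_cast
    field_simp
    ring
  have h4 : 0 < 2 * (m : ℝ) ^ 2 / (k * (k + 1)) := by positivity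
  linarith

theorem block_exponent_add_collapseOrder_pos {k m : ℕ} (hk : 1 ≤ k) (hm : 2 ≤ m) :
    0 < ((m : ℝ) - 1) * (1 - m / ((k + 1 : ℕ) : ℝ)) + 2 * collapseOrder k m := by
  rcases lt_or_ge m (k + 1) with h | h
  · have := block_exponent_pos hm (Or.inr (Nat.cast_lt (α := ℝ).2 h))
    linarith [collapseOrder_nonneg k m]
  · have hk' : (0 : ℝ) < k := by exact_mod_cast hk
    have h1 : (m : ℝ) * (m - k) / (2 * k) ≤ collapseOrder k m := le_max_right _ _
    have h2 : (k : ℝ) + 1 ≤ m := by exact_mod_cast h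
    have h3 : ((m : ℝ) - 1) * (1 - m / ((k + 1 : ℕ) : ℝ)) + 2 * ((m : ℝ) * (m - k) / (2 * k)) =
        (m ^ 2 + k * (m - (k + 1))) / (k * (k + 1)) := by
      push_cast
      field_simp
      ring
    have h4 : 0 < ((m : ℝ) ^ 2 + k * (m - (k + 1))) / (k * (k + 1)) := by
      have : 0 ≤ (k : ℝ) * (m - (k + 1)) := mul_nonneg hk'.le (by linarith)
      have : 0 < (m : ℝ) := by linarith
      positivity
    linarith

theorem locallyL2Integrable_of_mem_idealIpm {k : ℕ} (hk : 1 ≤ k) {s : ℝ} (hs : (k : ℝ) ≤ s)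
    {f : MvPolynomial (Fin N) ℂ} (hf : f ∈ idealIpm N k) :
    LocallyL2Integrable (bTypeFunction f ((k + 1 : ℕ) : ℝ) s) := by
  refine locallyL2Integrable_of_gapDominated fun σ => gapDominated_of_gapPoly fun η a ha T hT =>
    scaleExponent_pos hT (fun q => 2 * (((blockSigns q).card : ℝ) *
      collapseOrder k (blockCard T q))) ?_ (fun q => ?_) (fun h => ?_) fun q hq hq2 => ?_
  · have key := collapseOrder_le_sum_of_mem_support hk
      (eval_signChange_eq_zero (rename_mem_idealIpm hf σ) η) T _ (gapBlock_mem_range T) ha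
    rw [sum_range_succ_eq_add_Icc] at key
    simp only [Nat.cast_mul, Nat.cast_ofNat, Finset.sum_const_zero, zero_add, ← Finset.mul_sum]
    unfold blockCard
    linarith
  · have := collapseOrder_nonneg k (blockCard T q)
    positivity
  · have := zero_block_exponent_pos hk h hs
    rw [card_blockSigns, if_pos rfl]
    push_cast at this ⊢
    linarith
  · have := block_exponent_add_collapseOrder_pos hk hq2
    rw [card_blockSigns, if_neg (by rw [Finset.mem_Icc] at hq; omega)]
    push_cast at this ⊢
    linarith

end Cases

theorem mainTheorem5 (N : ℕ) (hN : 1 ≤ N) :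
    (∀ (r : ℕ) (s : ℝ) (f : MvPolynomial (Fin N) ℂ),
      2 ≤ r → r ≤ N → (r : ℝ) - 1 ≤ s → f ∈ idealIpm N (r - 1) →
        LocallyL2Integrable (bTypeFunction f (r : ℝ) s)) ∧
    (∀ (s : ℕ) (r : ℝ) (f : MvPolynomial (Fin N) ℂ),
      s ≤ N - 1 → (N : ℝ) + 1 ≤ r → f ∈ idealJ N s →
        LocallyL2Integrable (bTypeFunction f r (s : ℝ))) ∧
    (∀ (r s : ℝ) (f : MvPolynomial (Fin N) ℂ),
      (N : ℝ) - 1 < s → (N : ℝ) + 1 ≤ r →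
        LocallyL2Integrable (bTypeFunction f r s)) ∧
    (∀ (r s : ℝ) (f : MvPolynomial (Fin N) ℂ),
      r < 0 → s < 0 →
        LocallyL2Integrable (bTypeFunction f r s)) := by
  refine ⟨fun r s f hr _ hs hf => ?_, fun s r f _ hr hf => locallyL2Integrable_of_mem_idealJ hr hf,
    fun r s f hs hr => ?_, fun r s f hr hs => ?_⟩
  · obtain ⟨k, rfl⟩ : ∃ k, r = k + 1 := ⟨r - 1, by omega⟩
    exact locallyL2Integrable_of_mem_idealIpm (by omega) (by push_cast at hs; linarith) hf
  · refine locallyL2Integrable_of_exponent_pos (Or.inr (by linarith)) (fun m hm hmN => ?_) f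
    have h1 : (1 : ℝ) ≤ m := by exact_mod_cast hm
    have h2 : (m : ℝ) ≤ N := by exact_mod_cast hmN
    exact div_pos (mul_pos (by linarith) (by linarith)) (by linarith)
  · refine locallyL2Integrable_of_exponent_pos (Or.inl hr) (fun m hm _ => ?_) f
    have h1 : (1 : ℝ) ≤ m := by exact_mod_cast hm
    exact div_pos_of_neg_of_neg (mul_neg_of_pos_of_neg (by linarith) (by linarith)) hr
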